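/- Let $T,\delta,R>0$. Consider, in space dimension $n=1$, a third order operator with principal symbol $L(t,\tau,\xi)=\tau^3+\sum_{j=0}^{2}a_j(t)\tau^j\xi^{3-j}$ and symbol of order two $M(t,\tau,\xi)=\sum_{j=0}^{2}b_j(t)\tau^j\xi^{2-j}$, where the coefficients $a_j$ (real-valued) and $b_j$ (complex-valued) are analytic on $]-\delta,T+\delta[$. Assume that for all $t\in[0,T]$ and $\xi\in\mathbb R$ the polynomial $L(t,\cdot,\xi)$ has only real roots $\tau_1(t,\xi)\le\tau_2(t,\xi)\le\tau_3(t,\xi)$ (weak hyperbolicity), and that the discriminant $\Delta_L=(\tau_1-\tau_2)^2(\tau_2-\tau_3)^2(\tau_3-\tau_1)^2$ is not identically zero on $[0,T]\times\mathbb R$. Put $$\widecheck M=M-\tfrac12\,\partial_t\partial_\tau L,$$ let $\lambda_1,\lambda_2,\lambda_3$ be the (real and distinct) roots in $\tau$ of $L-\partial_\tau^2L$, in increasing order, and let $S_3=\{(1,2,3),(2,3,1),(3,1,2)\}$. Then the following two conditions are equivalent. (i) There is a constant $C>0$ such that, for all $\xi\in\mathbb R$ with $|\xi|\ge R$, $$\int_0^T\sum_{(j,k,l)\in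 S_3}\frac{|\widecheck M(t,\lambda_j(t,\xi),\xi)|}{|\lambda_j(t,\xi)-\lambda_k(t,\xi)|\,|\lambda_j(t,\xi)-\lambda_l(t,\xi)|}\,dt\le C\log(1+|\xi|).$$ (ii) There are finitely many (possibly zero) distinct points $t_1,\dots,t_\nu\in\,]-\delta,T+\delta[$ and a constant $C>0$ such that $$\prod_{h=1}^{\nu}|t-t_h|\;|\widecheck M(t,\tau_j(t,\xi),\xi)|\le C\,|\tau_j(t,\xi)-\tau_k(t,\xi)|\,|\tau_j(t,\xi)-\tau_l(t,\xi)|$$ for all $(j,k,l)\in S_3$, all $t\in[0,T]$ and all $\xi\in\mathbb R$. -/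

import Mathlib

open Set Polynomial MeasureTheory

noncomputable section

namespace ThirdOrder

/-- The `j`-th real root, `j = 0, 1, 2, …`, of a real polynomial, the real roots being listed in
nondecreasing order and repeated according to multiplicity. (The value is `0` if there are
at most `j` real roots; this never happens for the split cubic polynomials used below.) -/
def orderedRoot (p : ℝ[X]) (j : ℕ) : ℝ :=
  (p.roots.sort (· ≤ ·)).getD j 0

/-- The principal symbol `L(t, τ, ξ) = τ³ + ∑_{j ≤ 2} a_j(t) τ^j ξ^(3-j)` in one space dimension,
as a polynomial in `τ`; `a j` is the coefficient of `∂_t^j ∂_x^(3-j)`. -/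
def symbolL (a : Fin 3 → ℝ → ℝ) (t ξ : ℝ) : ℝ[X] :=
  X ^ 3 + ∑ j : Fin 3, C (a j t * ξ ^ (3 - (j : ℕ))) * X ^ (j : ℕ)

/-- The symbol of order two `M(t, τ, ξ) = ∑_{j ≤ 2} b_j(t) τ^j ξ^(2-j)`;
`b j` is the (complex) coefficient of `∂_t^j ∂_x^(2-j)`. -/
def symbolM (b : Fin 3 → ℝ → ℂ) (t τ ξ : ℝ) : ℂ :=
  ∑ j : Fin 3, b j t * (τ : ℂ) ^ (j : ℕ) * (ξ : ℂ) ^ (2 - (j : ℕ))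

/-- The subprincipal symbol `M - (1/2) ∂_t ∂_τ L`. -/
def checkM (a : Fin 3 → ℝ → ℝ) (b : Fin 3 → ℝ → ℂ) (t τ ξ : ℝ) : ℂ :=
  symbolM b t τ ξ -
    (1 / 2 : ℂ) * ((deriv (fun s => (derivative (symbolL a s ξ)).eval τ) t : ℝ) : ℂ)

/-- The auxiliary polynomial `L - ∂_τ² L`. -/
def auxL (a : Fin 3 → ℝ → ℝ) (t ξ : ℝ) : ℝ[X] :=
  symbolL a t ξ - derivative (derivative (symbolL a t ξ))

/-- The roots `τ_j(t, ξ)` of `L(t, ·, ξ)`, in nondecreasing order. -/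
def tauRoot (a : Fin 3 → ℝ → ℝ) (j : Fin 3) (t ξ : ℝ) : ℝ :=
  orderedRoot (symbolL a t ξ) j

/-- The roots `λ_j(t, ξ)` of `L - ∂_τ² L`, in nondecreasing order. -/
def lambdaRoot (a : Fin 3 → ℝ → ℝ) (j : Fin 3) (t ξ : ℝ) : ℝ :=
  orderedRoot (auxL a t ξ) j

/-- The discriminant `Δ_L(t, ξ)` of `L`, in terms of its roots. -/
def discrL (a : Fin 3 → ℝ → ℝ) (t ξ : ℝ) : ℝ :=
  (tauRoot a 0 t ξ - tauRoot a 1 t ξ) ^ 2 * (tauRoot a 1 t ξ - tauRoot a 2 t ξ) ^ 2 *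
    (tauRoot a 2 t ξ - tauRoot a 0 t ξ) ^ 2

/-- Weak hyperbolicity on `[0, T]`: all the roots of `L(t, ·, ξ)` are real. -/
def WeaklyHyperbolic (T : ℝ) (a : Fin 3 → ℝ → ℝ) : Prop :=
  ∀ t ∈ Icc 0 T, ∀ ξ : ℝ, (symbolL a t ξ).Splits

/-- The cyclic triples `(1,2,3), (2,3,1), (3,1,2)`, with indices starting from `0`. -/
def S3 : Finset (Fin 3 × Fin 3 × Fin 3) :=
  {(0, 1, 2), (1, 2, 0), (2, 0, 1)}

/-- The integrand of the logarithmic Levi condition on the terms of order two. -/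
def leviIntegrand (a : Fin 3 → ℝ → ℝ) (b : Fin 3 → ℝ → ℂ) (t ξ : ℝ) : ℝ :=
  ∑ i ∈ S3, ‖checkM a b t (lambdaRoot a i.1 t ξ) ξ‖ /
    (|lambdaRoot a i.1 t ξ - lambdaRoot a i.2.1 t ξ| *
      |lambdaRoot a i.1 t ξ - lambdaRoot a i.2.2 t ξ|)

/-- The logarithmic Levi condition on the terms of order two, for the frequencies `|ξ| ≥ R`. -/
def LogLevi (T R : ℝ) (a : Fin 3 → ℝ → ℝ) (b : Fin 3 → ℝ → ℂ) : Prop :=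
  ∃ K > 0, ∀ ξ : ℝ, R ≤ |ξ| →
    IntervalIntegrable (fun t => leviIntegrand a b t ξ) volume 0 T ∧
      ∫ t in (0 : ℝ)..T, leviIntegrand a b t ξ ≤ K * Real.log (1 + |ξ|)

/-- The pointwise Levi condition; the elements of `S` are the (distinct) points `t_1, …, t_ν`. -/
def PointwiseLevi (T δ : ℝ) (a : Fin 3 → ℝ → ℝ) (b : Fin 3 → ℝ → ℂ) : Prop :=
  ∃ S : Finset ℝ, (S : Set ℝ) ⊆ Ioo (-δ) (T + δ) ∧
    ∃ K > 0, ∀ i ∈ S3, ∀ t ∈ Icc 0 T, ∀ ξ : ℝ,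
      (∏ s ∈ S, |t - s|) * ‖checkM a b t (tauRoot a i.1 t ξ) ξ‖ ≤
        K * (|tauRoot a i.1 t ξ - tauRoot a i.2.1 t ξ| *
          |tauRoot a i.1 t ξ - tauRoot a i.2.2 t ξ|)

end ThirdOrder

end

/-
Shifting `τ` by `a₂ ξ / 3` and dividing by `ξ` turns `L` into the depressed cubic
`x³ - 3 A x - 2 B`, and `L - ∂_τ² L` into the same cubic with `A` replaced by `A + 2 ξ⁻²`; both
conditions become bounds on the residues of `checkM / L` at these cubics.

Pointwise to logarithmic: the perturbed residues at `t` are bounded by a multiple of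
`1 + ∑ₕ (|ξ|⁻⁴ + (t - tₕ)²)^(-1/2)`, whose integral is logarithmic in `|ξ|`.

Logarithmic to pointwise: the sum of the squares of the residues is symmetric in the roots, hence
meromorphic in `t`. A pole of order at least three would make the residues at least
`|t - z|^(-3/2)` where `|ξ|⁻¹ ≤ |t - z|^n`, and the integral would grow like a power of `|ξ|`.
Hence all poles have order at most two, so each residue times `∏ₕ |t - tₕ|` is bounded.
-/

namespace ThirdOrder

section RootTriple

/-- `x` lists the roots of the depressed cubic `X ^ 3 - 3 A X - 2 B` with multiplicity, in any
order; the normalization of the coefficients makes `A ^ 3 - B ^ 2` the discriminant up to a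
factor `108`. -/
structure IsRootTriple {R : Type*} [CommRing R] (A B : R) (x : Fin 3 → R) : Prop where
  sum_eq : x 0 + x 1 + x 2 = 0
  pairs_eq : x 0 * x 1 + x 1 * x 2 + x 2 * x 0 = -3 * A
  prod_eq : x 0 * x 1 * x 2 = 2 * B

namespace IsRootTriple

section CommRing

variable {R : Type*} [CommRing R] {A B : R} {x : Fin 3 → R}

theorem rotate (h : IsRootTriple A B x) (k : Fin 3) : IsRootTriple A B fun j => x (k + j) := by
  obtain ⟨hsum, hpairs, hprod⟩ := h
  fin_cases k <;> constructor <;>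
    simp only [Fin.zero_eta, Fin.mk_one, Fin.reduceFinMk, Fin.reduceAdd, add_zero, zero_add] <;>
    first
    | linear_combination hsum
    | linear_combination hpairs
    | linear_combination hprod

theorem sum_rotate_eq (h : IsRootTriple A B x) (k : Fin 3) : x k + x (k + 1) + x (k + 2) = 0 := by
  simpa only [add_zero] using (h.rotate k).sum_eq

theorem gap_mul_gap (h : IsRootTriple A B x) (k : Fin 3) :
    (x k - x (k + 1)) * (x k - x (k + 2)) = 3 * (x k ^ 2 - A) := by
  obtain ⟨hsum, hpairs, -⟩ := h.rotate k
  simp only [add_zero] at hsum hpairs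
  linear_combination hpairs - 2 * x k * hsum

theorem sq_gap (h : IsRootTriple A B x) (k : Fin 3) :
    (x (k + 1) - x (k + 2)) ^ 2 = 12 * A - 3 * x k ^ 2 := by
  obtain ⟨hsum, hpairs, -⟩ := h.rotate k
  simp only [add_zero] at hsum hpairs
  linear_combination (x (k + 1) + x (k + 2) + 3 * x k) * hsum - 4 * hpairs

theorem cube_eq (h : IsRootTriple A B x) (k : Fin 3) : x k ^ 3 = 3 * A * x k + 2 * B := by
  obtain ⟨hsum, hpairs, hprod⟩ := h.rotate k
  simp only [add_zero] at hsum hpairs hprod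
  linear_combination hprod + x k ^ 2 * hsum - x k * hpairs

theorem discr_eq (h : IsRootTriple A B x) :
    (x 0 - x 1) ^ 2 * (x 1 - x 2) ^ 2 * (x 2 - x 0) ^ 2 = 108 * (A ^ 3 - B ^ 2) := by
  obtain ⟨hsum, hpairs, hprod⟩ := h
  obtain hx : x 2 = -x 0 - x 1 := by linear_combination hsum
  rw [hx] at hpairs hprod ⊢
  generalize hp : x 0 * x 1 + x 1 * (-x 0 - x 1) + (-x 0 - x 1) * x 0 = p at hpairs
  generalize hq : x 0 * x 1 * (-x 0 - x 1) = q at hprod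
  calc (x 0 - x 1) ^ 2 * (x 1 - (-x 0 - x 1)) ^ 2 * (-x 0 - x 1 - x 0) ^ 2
      = -4 * p ^ 3 - 27 * q ^ 2 := by rw [← hp, ← hq]; ring
    _ = 108 * (A ^ 3 - B ^ 2) := by rw [hpairs, hprod]; ring

theorem sq_deriv_mul_sq_gap (h : IsRootTriple A B x) (k : Fin 3) :
    (3 * (x k ^ 2 - A)) ^ 2 * (12 * A - 3 * x k ^ 2) = 108 * (A ^ 3 - B ^ 2) := by
  linear_combination -27 * (x k ^ 3 - 3 * A * x k + 2 * B) * h.cube_eq k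

theorem sum_pow_add_three (h : IsRootTriple A B x) (m : ℕ) :
    ∑ k, x k ^ (m + 3) = 3 * A * ∑ k, x k ^ (m + 1) + 2 * B * ∑ k, x k ^ m := by
  simp only [pow_add _ m 3, h.cube_eq, Finset.mul_sum, ← Finset.sum_add_distrib]
  exact Finset.sum_congr rfl fun k _ => by ring

theorem sum_sq_eq (h : IsRootTriple A B x) : ∑ k, x k ^ 2 = 6 * A := by
  rw [Fin.sum_univ_three]
  linear_combination (x 0 + x 1 + x 2) * h.sum_eq - 2 * h.pairs_eq

theorem sum_pow_eq (h : IsRootTriple A B x) :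
    ∑ k, x k ^ 3 = 6 * B ∧ ∑ k, x k ^ 4 = 18 * A ^ 2 ∧ ∑ k, x k ^ 5 = 30 * A * B ∧
      ∑ k, x k ^ 6 = 54 * A ^ 3 + 12 * B ^ 2 := by
  have hone : ∑ k, x k = 0 := by rw [Fin.sum_univ_three, h.sum_eq]
  have hcube : ∑ k, x k ^ 3 = 6 * B := by
    rw [h.sum_pow_add_three 0]
    simp only [zero_add, pow_one, pow_zero, hone, Fin.sum_univ_three]
    ring
  have hfour : ∑ k, x k ^ 4 = 18 * A ^ 2 := by
    rw [h.sum_pow_add_three 1, h.sum_sq_eq]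
    simp only [pow_one, hone]
    ring
  refine ⟨hcube, hfour, ?_, ?_⟩
  · rw [h.sum_pow_add_three 2, hcube, h.sum_sq_eq]
    ring
  · rw [h.sum_pow_add_three 3, hfour, hcube]
    ring

end CommRing

section Real

variable {A B : ℝ} {x : Fin 3 → ℝ}

theorem sq_le (h : IsRootTriple A B x) (k : Fin 3) : x k ^ 2 ≤ 4 * A := by
  linarith [h.sq_gap k, sq_nonneg (x (k + 1) - x (k + 2))]

theorem sq_le_cube (h : IsRootTriple A B x) : B ^ 2 ≤ A ^ 3 := by
  have : 0 ≤ (x 0 - x 1) ^ 2 * (x 1 - x 2) ^ 2 * (x 2 - x 0) ^ 2 := by positivity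
  linarith [h.discr_eq]

theorem deriv_ne_zero (h : IsRootTriple A B x) (hAB : A ^ 3 ≠ B ^ 2) (k : Fin 3) :
    3 * (x k ^ 2 - A) ≠ 0 := by
  intro hzero
  have := h.sq_deriv_mul_sq_gap k
  rw [hzero, zero_pow two_ne_zero, zero_mul] at this
  exact hAB (by linarith)

theorem sub_le_deriv (h : IsRootTriple A B x) (k : Fin 3) :
    A ^ 3 - B ^ 2 ≤ A ^ 2 * |3 * (x k ^ 2 - A)| := by
  have hA : 0 ≤ A := by linarith [h.sq_le k, sq_nonneg (x k)]
  have hle : |3 * (x k ^ 2 - A)| ≤ 9 * A := by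
    rw [abs_le]
    constructor <;> linarith [h.sq_le k, sq_nonneg (x k)]
  have : 108 * (A ^ 3 - B ^ 2) ≤ 108 * (A ^ 2 * |3 * (x k ^ 2 - A)|) := calc
    108 * (A ^ 3 - B ^ 2)
        = |3 * (x k ^ 2 - A)| * |3 * (x k ^ 2 - A)| * (12 * A - 3 * x k ^ 2) := by
      rw [← h.sq_deriv_mul_sq_gap k, ← sq, sq_abs]
    _ ≤ |3 * (x k ^ 2 - A)| * (9 * A) * (12 * A) := by
      gcongr
      · linarith [h.sq_le k]
      · linarith [sq_nonneg (x k)]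
    _ = 108 * (A ^ 2 * |3 * (x k ^ 2 - A)|) := by ring
  linarith

theorem injective (h : IsRootTriple A B x) (hAB : A ^ 3 ≠ B ^ 2) : Function.Injective x := by
  have hgap (k : Fin 3) : x k ≠ x (k + 1) ∧ x k ≠ x (k + 2) := by
    have := h.deriv_ne_zero hAB k
    rw [← h.gap_mul_gap k, mul_ne_zero_iff] at this
    simpa only [sub_ne_zero] using this
  intro i j hij
  by_contra hne
  have hcases : ∀ i j : Fin 3, i ≠ j → j = i + 1 ∨ j = i + 2 := by decide
  obtain rfl | rfl := hcases i j hne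
  exacts [(hgap i).1 hij, (hgap i).2 hij]

end Real

end IsRootTriple

theorem nonneg_of_sq_le_cube {A B : ℝ} (hAB : B ^ 2 ≤ A ^ 3) : 0 ≤ A :=
  (show Odd 3 by decide).pow_nonneg_iff.mp ((sq_nonneg B).trans hAB)

/-- The roots of `X ^ 3 - 3 A X - 2 B`, where `B ^ 2 ≤ A ^ 3`, by Viète's trigonometric formula;
unlike the ordered roots of the polynomial, they visibly depend continuously on `A` and `B`. -/
noncomputable def vieteRoot (A B : ℝ) : Fin 3 → ℝ :=
  let θ := Real.arccos (B / √A ^ 3) / 3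
  ![2 * √A * Real.cos θ, √A * (-Real.cos θ + √3 * Real.sin θ),
    √A * (-Real.cos θ - √3 * Real.sin θ)]

theorem sqrt_pow_mul_cos_arccos {A B : ℝ} (hAB : B ^ 2 ≤ A ^ 3) :
    √A ^ 3 * Real.cos (Real.arccos (B / √A ^ 3)) = B := by
  have habs : |B| ≤ √A ^ 3 := by
    refine abs_le_of_sq_le_sq ?_ (by positivity)
    rwa [← pow_mul, mul_comm 3, pow_mul, Real.sq_sqrt (nonneg_of_sq_le_cube hAB)]
  rcases (by positivity : 0 ≤ √A ^ 3).eq_or_lt with hzero | hpos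
  · rw [← hzero, zero_mul]
    exact (abs_nonpos_iff.mp (habs.trans hzero.ge)).symm
  · obtain ⟨hle, hge⟩ := abs_le.mp ((abs_div B _).trans_le
      ((div_le_one (abs_pos.mpr hpos.ne')).mpr (habs.trans (le_abs_self _))))
    rw [Real.cos_arccos hle hge, mul_div_cancel₀ _ hpos.ne']

theorem isRootTriple_vieteRoot {A B : ℝ} (hAB : B ^ 2 ≤ A ^ 3) :
    IsRootTriple A B (vieteRoot A B) := by
  have hA : √A ^ 2 = A := Real.sq_sqrt (nonneg_of_sq_le_cube hAB)
  have hthree : √(3 : ℝ) ^ 2 = 3 := Real.sq_sqrt (by norm_num)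
  set θ := Real.arccos (B / √A ^ 3) / 3 with hθ
  have hsin : Real.sin θ ^ 2 = 1 - Real.cos θ ^ 2 := Real.sin_sq θ
  have hcos : √A ^ 3 * (4 * Real.cos θ ^ 3 - 3 * Real.cos θ) = B := by
    rw [← Real.cos_three_mul, hθ, mul_div_cancel₀ _ three_ne_zero, sqrt_pow_mul_cos_arccos hAB]
  constructor <;>
    simp only [vieteRoot, ← hθ, Matrix.cons_val_zero, Matrix.cons_val_one, Matrix.cons_val]
  · ring
  · linear_combination (-3 * Real.cos θ ^ 2 - 3 * Real.sin θ ^ 2) * hA - 3 * A * hsin -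
      √A ^ 2 * Real.sin θ ^ 2 * hthree
  · linear_combination 2 * hcos - 2 * √A ^ 3 * Real.cos θ * Real.sin θ ^ 2 * hthree -
      6 * √A ^ 3 * Real.cos θ * hsin

theorem continuousOn_vieteRoot {α : Type*} [TopologicalSpace α] {A B : α → ℝ} {s : Set α}
    (hA : ContinuousOn A s) (hB : ContinuousOn B s) (hpos : ∀ t ∈ s, 0 < A t) (k : Fin 3) :
    ContinuousOn (fun t => vieteRoot (A t) (B t) k) s := by
  have hsqrt : ContinuousOn (fun t => √(A t)) s := hA.sqrt
  have hθ : ContinuousOn (fun t => Real.arccos (B t / √(A t) ^ 3) / 3) s :=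
    (Real.continuous_arccos.comp_continuousOn (hB.div (hsqrt.pow 3) fun t ht =>
      pow_ne_zero 3 (Real.sqrt_pos.mpr (hpos t ht)).ne')).div_const 3
  have hcos := Real.continuous_cos.comp_continuousOn hθ
  have hsin := Real.continuous_sin.comp_continuousOn hθ
  fin_cases k
  · exact (continuousOn_const.mul hsqrt).mul hcos
  · exact hsqrt.mul (hcos.neg.add (continuousOn_const.mul hsin))
  · exact hsqrt.mul (hcos.neg.sub (continuousOn_const.mul hsin))

end RootTriple

section Perturbation

/-- The value at `y` of the quotient of `X ^ 3 - 3 A X - 2 B` by `X - s`, where `s` is a root. -/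
def cofactor (A s y : ℝ) : ℝ := y ^ 2 + y * s + s ^ 2 - 3 * A

namespace IsRootTriple

variable {A B ε : ℝ} {x : Fin 3 → ℝ}

theorem sq_le_of_perturbed (hAB : B ^ 2 ≤ A ^ 3) (hx : IsRootTriple (A + 2 * ε ^ 2) B x)
    (k : Fin 3) : x k ^ 2 ≤ 4 * A + 6 * ε ^ 2 := by
  by_contra! hlt
  have hA := nonneg_of_sq_le_cube hAB
  have hcube : x k ^ 2 * (x k ^ 2 - 3 * (A + 2 * ε ^ 2)) ^ 2 = 4 * B ^ 2 := by
    linear_combination (x k ^ 3 - 3 * (A + 2 * ε ^ 2) * x k + 2 * B) * hx.cube_eq k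
  have hsq : A ^ 2 < (x k ^ 2 - 3 * (A + 2 * ε ^ 2)) ^ 2 := by
    apply pow_lt_pow_left₀ _ hA two_ne_zero
    linarith
  have hxk : 0 < x k ^ 2 := by linarith [sq_nonneg ε]
  have : 4 * A * A ^ 2 ≤ x k ^ 2 * A ^ 2 := by gcongr; linarith [sq_nonneg ε]
  linarith [mul_lt_mul_of_pos_left hsq hxk]

theorem sq_gap_ge_of_perturbed (hAB : B ^ 2 ≤ A ^ 3) (hx : IsRootTriple (A + 2 * ε ^ 2) B x)
    (k : Fin 3) : 6 * ε ^ 2 ≤ (x (k + 1) - x (k + 2)) ^ 2 := by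
  linarith [hx.sq_gap k, hx.sq_le_of_perturbed hAB k]

theorem deriv_ge_of_perturbed (hAB : B ^ 2 ≤ A ^ 3)
    (hx : IsRootTriple (A + 2 * ε ^ 2) B x) (k : Fin 3) :
    6 * ε ^ 2 ≤ |3 * (x k ^ 2 - (A + 2 * ε ^ 2))| ∧
      3 * ε * |x k| ≤ |3 * (x k ^ 2 - (A + 2 * ε ^ 2))| := by
  have hu : 6 * ε ^ 2 ≤ (x k - x (k + 1)) ^ 2 := by
    simpa only [add_assoc, Fin.reduceAdd, add_zero] using hx.sq_gap_ge_of_perturbed hAB (k + 2)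
  have hv : 6 * ε ^ 2 ≤ (x k - x (k + 2)) ^ 2 := by
    simpa only [add_assoc, Fin.reduceAdd, add_zero, sub_sq_comm (x (k + 2))]
      using hx.sq_gap_ge_of_perturbed hAB (k + 1)
  have hsum : 3 * x k = (x k - x (k + 1)) + (x k - x (k + 2)) := by
    linear_combination hx.sum_rotate_eq k
  rw [← hx.gap_mul_gap k]
  set u := x k - x (k + 1)
  set v := x k - x (k + 2)
  have huv : 6 * ε ^ 2 * v ^ 2 ≤ u ^ 2 * v ^ 2 := by gcongr
  have hvu : u ^ 2 * (6 * ε ^ 2) ≤ u ^ 2 * v ^ 2 := by gcongr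
  constructor
  · refine (le_abs_self _).trans (sq_le_sq.mp ?_)
    calc (6 * ε ^ 2) ^ 2 = 6 * ε ^ 2 * (6 * ε ^ 2) := sq _
      _ ≤ 6 * ε ^ 2 * v ^ 2 := by gcongr
      _ ≤ (u * v) ^ 2 := by rwa [mul_pow]
  · refine (le_abs_self _).trans (sq_le_sq.mp ?_)
    calc (3 * ε * |x k|) ^ 2 = ε ^ 2 * (3 * x k) ^ 2 := by rw [mul_pow, sq_abs]; ring
      _ ≤ ε ^ 2 * (2 * (u ^ 2 + v ^ 2)) := by rw [hsum]; gcongr; exact add_sq_le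
      _ ≤ (u * v) ^ 2 := by rw [mul_pow]; linarith [sq_nonneg (u * v), mul_pow u v 2]

end IsRootTriple

theorem abs_cofactor_le {A A' B s y ε : ℝ} (hε : 0 < ε) (hA : |A' - A| ≤ 2 * ε ^ 2)
    (hs : s ^ 3 = 3 * A * s + 2 * B) (hy : y ^ 3 = 3 * A' * y + 2 * B) :
    |cofactor A s y| ≤ |3 * (y ^ 2 - A')| + 7 * ε ^ 2 + 6 * ε * |y| := by
  have hmul : (s - y) * cofactor A s y = -(3 * (A' - A)) * y := by
    rw [cofactor]; linear_combination hs - hy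
  have hadd : cofactor A s y = 3 * (y ^ 2 - A') + 3 * (A' - A) + (s - y) * (s - y + 3 * y) := by
    rw [cofactor]; ring
  have hA' : |3 * (A' - A)| ≤ 6 * ε ^ 2 := by
    rw [abs_mul, Nat.abs_ofNat]; linarith
  rcases le_or_gt ε |s - y| with hfar | hnear
  · have : ε * |cofactor A s y| ≤ ε * (6 * ε * |y|) := calc
      ε * |cofactor A s y| ≤ |s - y| * |cofactor A s y| := by gcongr
      _ = |3 * (A' - A)| * |y| := by rw [← abs_mul, hmul, abs_mul, abs_neg]
      _ ≤ 6 * ε ^ 2 * |y| := by gcongr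
      _ = ε * (6 * ε * |y|) := by ring
    calc |cofactor A s y| ≤ 6 * ε * |y| := le_of_mul_le_mul_left this hε
      _ ≤ |3 * (y ^ 2 - A')| + 7 * ε ^ 2 + 6 * ε * |y| := le_add_of_nonneg_left (by positivity)
  · have hprod : |(s - y) * (s - y + 3 * y)| ≤ ε * (ε + 3 * |y|) := by
      rw [abs_mul]
      refine mul_le_mul hnear.le ?_ (abs_nonneg _) hε.le
      calc |s - y + 3 * y| ≤ |s - y| + |3 * y| := abs_add_le _ _
        _ ≤ ε + 3 * |y| := by rw [abs_mul, Nat.abs_ofNat]; gcongr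
    calc |cofactor A s y|
        ≤ |3 * (y ^ 2 - A')| + |3 * (A' - A)| + |(s - y) * (s - y + 3 * y)| := by
          rw [hadd]; exact (abs_add_le _ _).trans (by gcongr; exact abs_add_le _ _)
      _ ≤ |3 * (y ^ 2 - A')| + 6 * ε ^ 2 + ε * (ε + 3 * |y|) := by gcongr
      _ ≤ _ := by nlinarith [mul_nonneg hε.le (abs_nonneg y)]

end Perturbation

section Residues

variable {E : Type*} [NormedAddCommGroup E]

section NormedSpace

variable [NormedSpace ℝ E]

/-- The polynomial `d 0 + d 1 X + d 2 X ^ 2`, evaluated at `x`. -/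
noncomputable def quad (d : Fin 3 → E) (x : ℝ) : E := ∑ j : Fin 3, x ^ (j : ℕ) • d j

/-- The sum of the norms of the residues of the rational function `quad d / p`, where `x` lists the
roots of `p = X ^ 3 - 3 A X - 2 B`; the denominators are the values of `p'` at the roots. -/
noncomputable def residueSum (d : Fin 3 → E) (A : ℝ) (x : Fin 3 → ℝ) : ℝ :=
  ∑ k, ‖quad d (x k)‖ / |3 * (x k ^ 2 - A)|

theorem residueSum_nonneg (d : Fin 3 → E) (A : ℝ) (x : Fin 3 → ℝ) : 0 ≤ residueSum d A x :=
  Finset.sum_nonneg fun _ _ => by positivity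

theorem IsRootTriple.pow_eq_sum_cofactor {A B : ℝ} {s : Fin 3 → ℝ} (hs : IsRootTriple A B s)
    (hAB : A ^ 3 ≠ B ^ 2) (y : ℝ) (j : Fin 3) :
    y ^ (j : ℕ) = ∑ k, cofactor A (s k) y / (3 * (s k ^ 2 - A)) * s k ^ (j : ℕ) := by
  have hcof (k : Fin 3) : cofactor A (s k) y = (y - s (k + 1)) * (y - s (k + 2)) := by
    obtain ⟨hsum, hpairs, -⟩ := hs.rotate k
    simp only [add_zero] at hsum hpairs
    rw [cofactor]
    linear_combination (y + s k) * hsum - hpairs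
  have hne {i j : Fin 3} (hij : i ≠ j) : s i - s j ≠ 0 :=
    sub_ne_zero.mpr ((hs.injective hAB).ne hij)
  have h01 := hne (show (0 : Fin 3) ≠ 1 by decide)
  have h02 := hne (show (0 : Fin 3) ≠ 2 by decide)
  have h12 := hne (show (1 : Fin 3) ≠ 2 by decide)
  have h10 := hne (show (1 : Fin 3) ≠ 0 by decide)
  have h20 := hne (show (2 : Fin 3) ≠ 0 by decide)
  have h21 := hne (show (2 : Fin 3) ≠ 1 by decide)
  simp only [hcof, ← hs.gap_mul_gap, Fin.sum_univ_three, zero_add, Fin.reduceAdd]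
  fin_cases j <;> dsimp only <;> field_simp <;> ring

theorem IsRootTriple.quad_eq_sum_cofactor {A B : ℝ} {s : Fin 3 → ℝ} (hs : IsRootTriple A B s)
    (hAB : A ^ 3 ≠ B ^ 2) (d : Fin 3 → E) (y : ℝ) :
    quad d y = ∑ k, (cofactor A (s k) y / (3 * (s k ^ 2 - A))) • quad d (s k) := by
  simp only [quad, Finset.smul_sum, smul_smul]
  rw [Finset.sum_comm]
  simp only [← Finset.sum_smul, ← hs.pow_eq_sum_cofactor hAB]

theorem residueSum_le_of_cofactor_le {A A' B C : ℝ} {s y : Fin 3 → ℝ} (hs : IsRootTriple A B s)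
    (hAB : A ^ 3 ≠ B ^ 2) (hC : 0 ≤ C)
    (hle : ∀ k l, |cofactor A (s l) (y k)| ≤ C * |3 * (y k ^ 2 - A')|) (d : Fin 3 → E) :
    residueSum d A' y ≤ 3 * C * residueSum d A s := by
  have hterm (k : Fin 3) : ‖quad d (y k)‖ / |3 * (y k ^ 2 - A')| ≤ C * residueSum d A s := by
    refine div_le_of_le_mul₀ (abs_nonneg _) (mul_nonneg hC (residueSum_nonneg d A s)) ?_
    rw [hs.quad_eq_sum_cofactor hAB, residueSum, Finset.mul_sum, Finset.sum_mul]
    refine norm_sum_le_of_le _ fun l _ => ?_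
    calc ‖(cofactor A (s l) (y k) / (3 * (s l ^ 2 - A))) • quad d (s l)‖
        = |cofactor A (s l) (y k)| * (‖quad d (s l)‖ / |3 * (s l ^ 2 - A)|) := by
          rw [norm_smul, norm_div, Real.norm_eq_abs, Real.norm_eq_abs]; ring
      _ ≤ C * |3 * (y k ^ 2 - A')| * (‖quad d (s l)‖ / |3 * (s l ^ 2 - A)|) := by
          gcongr; exact hle k l
      _ = _ := by ring
  calc residueSum d A' y ≤ ∑ _k : Fin 3, C * residueSum d A s :=
        Finset.sum_le_sum fun k _ => hterm k
    _ = 3 * C * residueSum d A s := by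
        rw [Finset.sum_const, Finset.card_univ, Fintype.card_fin, nsmul_eq_mul]; push_cast; ring

theorem residueSum_perturbed_le {A B ε : ℝ} {x s : Fin 3 → ℝ} (hs : IsRootTriple A B s)
    (hAB : A ^ 3 ≠ B ^ 2) (hε : 0 < ε) (hx : IsRootTriple (A + 2 * ε ^ 2) B x) (d : Fin 3 → E) :
    residueSum d (A + 2 * ε ^ 2) x ≤ 15 * residueSum d A s := by
  have hcof (k l : Fin 3) :
      |cofactor A (s l) (x k)| ≤ 5 * |3 * (x k ^ 2 - (A + 2 * ε ^ 2))| := by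
    obtain ⟨hsq, hlin⟩ := hx.deriv_ge_of_perturbed hs.sq_le_cube k
    have hsub : |A + 2 * ε ^ 2 - A| ≤ 2 * ε ^ 2 := by
      rw [add_sub_cancel_left, abs_of_nonneg (by positivity)]
    linarith [abs_cofactor_le hε hsub (hs.cube_eq l) (hx.cube_eq k),
      abs_nonneg (3 * (x k ^ 2 - (A + 2 * ε ^ 2)))]
  linarith [residueSum_le_of_cofactor_le hs hAB (by norm_num) hcof d]

theorem residueSum_le_perturbed {A B ε K : ℝ} {x s : Fin 3 → ℝ} (hs : IsRootTriple A B s)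
    (hε : 0 < ε) (hε1 : ε ≤ 1) (hx : IsRootTriple (A + 2 * ε ^ 2) B x) (hK : ∀ k, |s k| ≤ K)
    (hderiv : ∀ k, ε ≤ |3 * (s k ^ 2 - A)|) (d : Fin 3 → E) :
    residueSum d A s ≤ 3 * (8 + 6 * K) * residueSum d (A + 2 * ε ^ 2) x := by
  have hA := nonneg_of_sq_le_cube hs.sq_le_cube
  have hAB : (A + 2 * ε ^ 2) ^ 3 ≠ B ^ 2 := by
    refine (hs.sq_le_cube.trans_lt ?_).ne'
    gcongr
    exact lt_add_of_pos_right A (by positivity)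
  have hK0 : 0 ≤ K := (abs_nonneg _).trans (hK 0)
  refine residueSum_le_of_cofactor_le hx hAB (by positivity) (fun k l => ?_) d
  have hsub : |A - (A + 2 * ε ^ 2)| ≤ 2 * ε ^ 2 := by
    rw [sub_add_cancel_left, abs_neg, abs_of_nonneg (by positivity)]
  calc |cofactor (A + 2 * ε ^ 2) (x l) (s k)|
      ≤ |3 * (s k ^ 2 - A)| + 7 * (ε * ε) + 6 * ε * |s k| := by
        rw [← sq]; exact abs_cofactor_le hε hsub (hx.cube_eq l) (hs.cube_eq k)
    _ ≤ |3 * (s k ^ 2 - A)| + 7 * (1 * |3 * (s k ^ 2 - A)|) + 6 * |3 * (s k ^ 2 - A)| * K := by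
        gcongr
        exacts [hderiv k, hderiv k, hK k]
    _ = (8 + 6 * K) * |3 * (s k ^ 2 - A)| := by ring

end NormedSpace

section InnerProductSpace

variable [InnerProductSpace ℝ E]

open scoped InnerProductSpace

/-- The numerator, over `6 (A ^ 3 - B ^ 2)`, of the sum of the squared norms of the residues of
`quad d / (X ^ 3 - 3 A X - 2 B)`. -/
noncomputable def residueForm (A B : ℝ) (d : Fin 3 → E) : ℝ :=
  A * ⟪d 0, d 0⟫_ℝ - 2 * B * ⟪d 0, d 1⟫_ℝ + A ^ 2 * (⟪d 1, d 1⟫_ℝ + 2 * ⟪d 0, d 2⟫_ℝ) -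
    2 * A * B * ⟪d 1, d 2⟫_ℝ + (3 * A ^ 3 - 2 * B ^ 2) * ⟪d 2, d 2⟫_ℝ

theorem norm_quad_sq (d : Fin 3 → E) (y : ℝ) :
    ‖quad d y‖ ^ 2 = ⟪d 0, d 0⟫_ℝ + 2 * y * ⟪d 0, d 1⟫_ℝ +
      y ^ 2 * (⟪d 1, d 1⟫_ℝ + 2 * ⟪d 0, d 2⟫_ℝ) +
      2 * y ^ 3 * ⟪d 1, d 2⟫_ℝ + y ^ 4 * ⟪d 2, d 2⟫_ℝ := by
  rw [← real_inner_self_eq_norm_sq]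
  simp only [quad, Fin.sum_univ_three, inner_add_left, inner_add_right, real_inner_smul_left,
    real_inner_smul_right, real_inner_comm (d 0), real_inner_comm (d 1) (d 2), Fin.val_zero,
    Fin.val_one, Fin.val_two, pow_zero, pow_one]
  ring

theorem IsRootTriple.sum_sq_residue_eq {A B : ℝ} {s : Fin 3 → ℝ} (hs : IsRootTriple A B s)
    (hAB : A ^ 3 ≠ B ^ 2) (d : Fin 3 → E) :
    ∑ k, (‖quad d (s k)‖ / |3 * (s k ^ 2 - A)|) ^ 2 =
      residueForm A B d / (6 * (A ^ 3 - B ^ 2)) := by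
  have hdisc : A ^ 3 - B ^ 2 ≠ 0 := sub_ne_zero.mpr hAB
  have hres (k : Fin 3) : (‖quad d (s k)‖ / |3 * (s k ^ 2 - A)|) ^ 2 =
      ‖quad d (s k)‖ ^ 2 * (12 * A - 3 * s k ^ 2) / (108 * (A ^ 3 - B ^ 2)) := by
    have hderiv : 3 * (s k ^ 2 - A) ≠ 0 := hs.deriv_ne_zero hAB k
    rw [div_pow, sq_abs, div_eq_div_iff (pow_ne_zero 2 hderiv) (by positivity),
      ← hs.sq_deriv_mul_sq_gap k]
    ring
  have hone := hs.sum_eq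
  have htwo := hs.sum_sq_eq
  obtain ⟨hthree, hfour, hfive, hsix⟩ := hs.sum_pow_eq
  simp only [hres, ← Finset.sum_div, norm_quad_sq, residueForm]
  simp only [Fin.sum_univ_three] at htwo hthree hfour hfive hsix ⊢
  rw [div_eq_div_iff (by positivity) (by positivity)]
  linear_combination 6 * (A ^ 3 - B ^ 2) * (
    ⟪d 0, d 0⟫_ℝ * (-3 * htwo) +
    2 * ⟪d 0, d 1⟫_ℝ * (12 * A * hone - 3 * hthree) +
    (⟪d 1, d 1⟫_ℝ + 2 * ⟪d 0, d 2⟫_ℝ) * (12 * A * htwo - 3 * hfour) +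
    2 * ⟪d 1, d 2⟫_ℝ * (12 * A * hthree - 3 * hfive) +
    ⟪d 2, d 2⟫_ℝ * (12 * A * hfour - 3 * hsix))

end InnerProductSpace

end Residues

section LogarithmicIntegrals

theorem arsinh_le_log {x : ℝ} (hx : 0 ≤ x) : Real.arsinh x ≤ Real.log (1 + 2 * x) := by
  have hsqrt : √(1 + x ^ 2) ≤ 1 + x := by
    rw [Real.sqrt_le_left (by positivity)]
    linarith [add_sq 1 x]
  exact Real.log_le_log (by positivity) (by linarith)

theorem integral_inv_sqrt_sq_add_sq {e : ℝ} (he : 0 < e) (l u s : ℝ) :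
    ∫ t in l..u, (√(e ^ 2 + (t - s) ^ 2))⁻¹ =
      Real.arsinh ((u - s) / e) - Real.arsinh ((l - s) / e) := by
  refine intervalIntegral.integral_eq_sub_of_hasDerivAt
    (f := fun t => Real.arsinh ((t - s) / e)) (fun t _ => ?_) ?_
  · have hlin : HasDerivAt (fun t => (t - s) / e) (1 / e) t :=
      ((hasDerivAt_id t).sub_const s).div_const e
    refine hlin.arsinh.congr_deriv ?_
    have hsqrt : √(e ^ 2 + (t - s) ^ 2) = √(1 + ((t - s) / e) ^ 2) * e := by
      rw [show e ^ 2 + (t - s) ^ 2 = (1 + ((t - s) / e) ^ 2) * e ^ 2 by field_simp,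
        Real.sqrt_mul (by positivity), Real.sqrt_sq he.le]
    rw [hsqrt, smul_eq_mul, mul_inv, one_div]
  · refine (Continuous.inv₀ (by fun_prop) fun t => ?_).intervalIntegrable _ _
    positivity

theorem integral_inv_sqrt_sq_add_sq_le {l u s D e : ℝ} (he : 0 < e) (hl : |l - s| ≤ D)
    (hu : |u - s| ≤ D) :
    ∫ t in l..u, (√(e ^ 2 + (t - s) ^ 2))⁻¹ ≤ 2 * Real.log (1 + 2 * (D / e)) := by
  have hD : 0 ≤ D := (abs_nonneg _).trans hl
  have harsinh {y : ℝ} (hy : y ≤ D) : Real.arsinh (y / e) ≤ Real.log (1 + 2 * (D / e)) :=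
    (Real.arsinh_le_arsinh.mpr (by gcongr)).trans (arsinh_le_log (by positivity))
  rw [integral_inv_sqrt_sq_add_sq he, sub_eq_add_neg, ← Real.arsinh_neg, ← neg_div, two_mul]
  exact add_le_add (harsinh ((le_abs_self _).trans hu)) (harsinh ((neg_le_abs _).trans hl))

theorem le_sum_inv_sqrt {S : Finset ℝ} {C e t y : ℝ} (hC : 0 ≤ C) (he : 0 < e)
    (hnear : y ≤ C / e) (hfar : t ∉ S → y ≤ C * (1 + ∑ s ∈ S, |t - s|⁻¹)) :
    y ≤ 2 * C * (1 + ∑ s ∈ S, (√(e ^ 2 + (t - s) ^ 2))⁻¹) := by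
  have hsqrt {r v : ℝ} (hr : 0 < r) (her : e ≤ r) (hv : |v| ≤ r) :
      r⁻¹ ≤ 2 * (√(e ^ 2 + v ^ 2))⁻¹ := by
    have hle : √(e ^ 2 + v ^ 2) ≤ 2 * r := by
      rw [Real.sqrt_le_left (by positivity)]
      linarith [pow_le_pow_left₀ he.le her 2, sq_le_sq.mpr (hv.trans (le_abs_self r)), sq_nonneg r]
    calc r⁻¹ = 2 * (2 * r)⁻¹ := by rw [mul_inv]; ring
      _ ≤ 2 * (√(e ^ 2 + v ^ 2))⁻¹ := by gcongr
  have hnonneg : ∀ s ∈ S, 0 ≤ (√(e ^ 2 + (t - s) ^ 2))⁻¹ := fun s _ => by positivity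
  by_cases hclose : ∃ s ∈ S, |t - s| ≤ e
  · obtain ⟨s, hs, hse⟩ := hclose
    calc y ≤ C * e⁻¹ := hnear
      _ ≤ C * (2 * (√(e ^ 2 + (t - s) ^ 2))⁻¹) := by gcongr; exact hsqrt he le_rfl hse
      _ = 2 * C * (√(e ^ 2 + (t - s) ^ 2))⁻¹ := by ring
      _ ≤ 2 * C * (1 + ∑ s ∈ S, (√(e ^ 2 + (t - s) ^ 2))⁻¹) := by
        gcongr
        exact (Finset.single_le_sum hnonneg hs).trans (le_add_of_nonneg_left zero_le_one)
  · push Not at hclose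
    have ht : t ∉ S := fun hts => by
      have := hclose t hts
      rw [sub_self, abs_zero] at this
      exact this.not_gt he
    calc y ≤ C * (1 + ∑ s ∈ S, |t - s|⁻¹) := hfar ht
      _ ≤ C * (2 * 1 + ∑ s ∈ S, 2 * (√(e ^ 2 + (t - s) ^ 2))⁻¹) := by
        gcongr with s hs
        · norm_num
        · exact hsqrt (he.trans (hclose s hs)) (hclose s hs).le le_rfl
      _ = 2 * C * (1 + ∑ s ∈ S, (√(e ^ 2 + (t - s) ^ 2))⁻¹) := by
        rw [← Finset.mul_sum]; ring

theorem exists_inv_prod_le_sum {𝕜 : Type*} [NormedField 𝕜] (S : Finset 𝕜) :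
    ∃ W ≥ 1, ∀ t ∉ S, (∏ s ∈ S, ‖t - s‖)⁻¹ ≤ W * (1 + ∑ s ∈ S, ‖t - s‖⁻¹) := by
  classical
  rcases S.eq_empty_or_nonempty with rfl | hS
  · exact ⟨1, le_rfl, fun t _ => by simp⟩
  refine ⟨1 + ∑ s ∈ S, ‖Lagrange.nodalWeight S id s‖, le_add_of_nonneg_right (by positivity),
    fun t ht => ?_⟩
  have hne : ∀ s ∈ S, t ≠ s := fun s hs h => ht (h ▸ hs)
  have hpartial : (∏ s ∈ S, (t - s))⁻¹ = ∑ s ∈ S, Lagrange.nodalWeight S id s * (t - s)⁻¹ := by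
    have := Lagrange.eval_interpolate_not_at_node (s := S) (v := id) (fun _ => (1 : 𝕜)) hne
    rw [show Lagrange.interpolate S (id : 𝕜 → 𝕜) (fun _ => (1 : 𝕜)) = 1 from
      Lagrange.interpolate_one Function.injective_id.injOn hS, eval_one,
      Lagrange.eval_nodal] at this
    simp only [id, mul_one] at this
    exact inv_eq_of_mul_eq_one_right this.symm
  calc (∏ s ∈ S, ‖t - s‖)⁻¹ = ‖∑ s ∈ S, Lagrange.nodalWeight S id s * (t - s)⁻¹‖ := by
        rw [← hpartial, norm_inv, norm_prod]
    _ ≤ ∑ s ∈ S, ‖Lagrange.nodalWeight S id s‖ * ‖t - s‖⁻¹ :=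
        norm_sum_le_of_le _ fun s _ => (norm_mul_le _ _).trans_eq (by rw [norm_inv])
    _ ≤ (∑ s ∈ S, ‖Lagrange.nodalWeight S id s‖) * ∑ s ∈ S, ‖t - s‖⁻¹ := by
        rw [Finset.mul_sum]
        gcongr with s hs
        exact Finset.single_le_sum (f := fun s => ‖Lagrange.nodalWeight S id s‖)
          (fun _ _ => norm_nonneg _) hs
    _ ≤ _ := by gcongr <;> exact le_add_of_nonneg_left zero_le_one

theorem exists_add_mul_log_le {a b D E : ℝ} (ha : 0 ≤ a) (hb : 0 ≤ b) (hD : 0 ≤ D) (hE : 0 < E) :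
    ∃ C > 0, ∀ ε ∈ Ioc 0 E, a + b * Real.log (1 + D / ε ^ 2) ≤ C * Real.log (1 + ε⁻¹) := by
  have hm : 0 < Real.log (1 + E⁻¹) := Real.log_pos (lt_add_of_pos_right 1 (by positivity))
  have hlogD : 0 ≤ Real.log (1 + D) := Real.log_nonneg (le_add_of_nonneg_right hD)
  refine ⟨(a + b * Real.log (1 + D)) / Real.log (1 + E⁻¹) + 2 * b + 1, by positivity,
    fun ε ⟨hε, hεE⟩ => ?_⟩
  have hmono : Real.log (1 + E⁻¹) ≤ Real.log (1 + ε⁻¹) := by gcongr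
  have hlog : Real.log (1 + D / ε ^ 2) ≤ Real.log (1 + D) + 2 * Real.log (1 + ε⁻¹) := by
    have hexpand : (1 + D) * (1 + ε⁻¹) ^ 2 =
        1 + D / ε ^ 2 + (D + 2 * ε⁻¹ * (1 + D) + (ε⁻¹) ^ 2) := by ring
    calc Real.log (1 + D / ε ^ 2) ≤ Real.log ((1 + D) * (1 + ε⁻¹) ^ 2) := by
          apply Real.log_le_log (by positivity)
          rw [hexpand]
          exact le_add_of_nonneg_right (by positivity)
      _ = _ := by
          rw [Real.log_mul (by positivity) (by positivity), Real.log_pow, Nat.cast_ofNat]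
  have hm' : 0 ≤ Real.log (1 + ε⁻¹) := hm.le.trans hmono
  calc a + b * Real.log (1 + D / ε ^ 2)
      ≤ a + b * (Real.log (1 + D) + 2 * Real.log (1 + ε⁻¹)) := by gcongr
    _ = (a + b * Real.log (1 + D)) / Real.log (1 + E⁻¹) * Real.log (1 + E⁻¹) +
          2 * b * Real.log (1 + ε⁻¹) := by rw [div_mul_cancel₀ _ hm.ne']; ring
    _ ≤ (a + b * Real.log (1 + D)) / Real.log (1 + E⁻¹) * Real.log (1 + ε⁻¹) +
          2 * b * Real.log (1 + ε⁻¹) := by gcongr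
    _ ≤ _ := by linarith

theorem exists_integral_one_add_sum_le (S : Finset ℝ) (l u : ℝ) :
    ∃ D ≥ 0, ∀ e > 0,
      IntervalIntegrable (fun t => 1 + ∑ s ∈ S, (√(e ^ 2 + (t - s) ^ 2))⁻¹) volume l u ∧
      ∫ t in l..u, (1 + ∑ s ∈ S, (√(e ^ 2 + (t - s) ^ 2))⁻¹) ≤
        (u - l) + S.card * (2 * Real.log (1 + 2 * (D / e))) := by
  have hD : ∀ s ∈ S, |l - s| + |u - s| ≤ ∑ s ∈ S, (|l - s| + |u - s|) := fun s hs =>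
    Finset.single_le_sum (f := fun s => |l - s| + |u - s|) (fun s _ => by positivity) hs
  refine ⟨∑ s ∈ S, (|l - s| + |u - s|), by positivity, fun e he => ?_⟩
  have hkernel (s : ℝ) : IntervalIntegrable (fun t => (√(e ^ 2 + (t - s) ^ 2))⁻¹) volume l u :=
    (Continuous.inv₀ (by fun_prop) fun t => by positivity).intervalIntegrable _ _
  have hsum : IntervalIntegrable (fun t => ∑ s ∈ S, (√(e ^ 2 + (t - s) ^ 2))⁻¹) volume l u := by
    simpa only [Finset.sum_fn] using IntervalIntegrable.sum S fun s _ => hkernel s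
  refine ⟨intervalIntegrable_const.add hsum, ?_⟩
  rw [intervalIntegral.integral_add intervalIntegrable_const hsum, intervalIntegral.integral_const,
    smul_eq_mul, mul_one, intervalIntegral.integral_finsetSum fun s _ => hkernel s, ← nsmul_eq_mul]
  gcongr
  exact Finset.sum_le_card_nsmul _ _ _ fun s hs => integral_inv_sqrt_sq_add_sq_le he
    ((le_add_of_nonneg_right (abs_nonneg _)).trans (hD s hs))
    ((le_add_of_nonneg_left (abs_nonneg _)).trans (hD s hs))

theorem exists_integral_le_log {l u C E : ℝ} {S : Finset ℝ} {f : ℝ → ℝ → ℝ} (hlu : l ≤ u)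
    (hC : 0 ≤ C) (hE : 0 < E) (hint : ∀ ε ∈ Ioc 0 E, IntervalIntegrable (f ε) volume l u)
    (hnear : ∀ ε ∈ Ioc 0 E, ∀ t ∈ Icc l u, f ε t ≤ C / ε ^ 2)
    (hfar : ∀ ε ∈ Ioc 0 E, ∀ᵐ t, t ∈ Icc l u → f ε t ≤ C * (∏ s ∈ S, |t - s|)⁻¹) :
    ∃ K > 0, ∀ ε ∈ Ioc 0 E, ∫ t in l..u, f ε t ≤ K * Real.log (1 + ε⁻¹) := by
  obtain ⟨W, hW, hprod⟩ := exists_inv_prod_le_sum S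
  obtain ⟨D, hD, hmajorant⟩ := exists_integral_one_add_sum_le S l u
  have hlen : 0 ≤ u - l := sub_nonneg.mpr hlu
  obtain ⟨K, hK, hlog⟩ := exists_add_mul_log_le (a := 2 * (C * W) * (u - l))
    (b := 2 * (C * W) * (S.card * 2)) (D := 2 * D) (by positivity) (by positivity) (by positivity)
    hE
  refine ⟨K, hK, fun ε hε => le_trans ?_ (hlog ε hε)⟩
  have he : 0 < ε ^ 2 := pow_pos hε.1 2
  obtain ⟨hmajorant_int, hmajorant_le⟩ := hmajorant (ε ^ 2) he
  calc ∫ t in l..u, f ε t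
      ≤ ∫ t in l..u, 2 * (C * W) * (1 + ∑ s ∈ S, (√((ε ^ 2) ^ 2 + (t - s) ^ 2))⁻¹) := by
        refine intervalIntegral.integral_mono_ae_restrict hlu (hint ε hε)
          (hmajorant_int.const_mul _) ?_
        filter_upwards [ae_restrict_mem measurableSet_Icc, ae_restrict_of_ae (hfar ε hε)]
          with t ht hfar_t
        refine le_sum_inv_sqrt (by positivity) he ((hnear ε hε t ht).trans ?_) fun htS => ?_
        · gcongr
          exact le_mul_of_one_le_right hC hW
        · rw [mul_assoc]
          exact (hfar_t ht).trans (by gcongr; exact hprod t htS)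
    _ ≤ 2 * (C * W) * ((u - l) + S.card * (2 * Real.log (1 + 2 * (D / ε ^ 2)))) := by
        rw [intervalIntegral.integral_const_mul]
        gcongr
    _ = _ := by rw [mul_div_assoc]; ring

end LogarithmicIntegrals

section PointwiseToLogarithmic

variable {E : Type*} [NormedAddCommGroup E] [NormedSpace ℝ E]

/-- The sum of the norms of the residues of `quad (d t) / (X ^ 3 - 3 (A t + 2 ε ^ 2) X - 2 B t)`.
The shift by `2 ε ^ 2` is what passing from `L` to `L - ∂_τ² L` does to the depressed cubic at
frequency `ε⁻¹`. -/
noncomputable def perturbedResidue (A B : ℝ → ℝ) (d : ℝ → Fin 3 → E) (ε t : ℝ) : ℝ :=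
  residueSum (d t) (A t + 2 * ε ^ 2) (vieteRoot (A t + 2 * ε ^ 2) (B t))

/-- The logarithmic Levi condition for the depressed cubic, with `ε` the inverse frequency. -/
def HasLogBound (A B : ℝ → ℝ) (d : ℝ → Fin 3 → E) (l u ε₀ : ℝ) : Prop :=
  ∃ K > 0, ∀ ε ∈ Ioc 0 ε₀, IntervalIntegrable (perturbedResidue A B d ε) volume l u ∧
    ∫ t in l..u, perturbedResidue A B d ε t ≤ K * Real.log (1 + ε⁻¹)

/-- The pointwise Levi condition for the depressed cubic, with exceptional points `S`. -/
def HasPointwiseBound (A B : ℝ → ℝ) (d : ℝ → Fin 3 → E) (I : Set ℝ) (S : Finset ℝ) (K : ℝ) :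
    Prop :=
  ∀ t ∈ I, ∀ x, IsRootTriple (A t) (B t) x →
    ∀ k, (∏ s ∈ S, |t - s|) * ‖quad (d t) (x k)‖ ≤ K * |3 * (x k ^ 2 - A t)|

theorem perturbedResidue_nonneg (A B : ℝ → ℝ) (d : ℝ → Fin 3 → E) (ε t : ℝ) :
    0 ≤ perturbedResidue A B d ε t :=
  residueSum_nonneg _ _ _

theorem isRootTriple_vieteRoot_perturbed {A B : ℝ} (hAB : B ^ 2 ≤ A ^ 3) (ε : ℝ) :
    IsRootTriple (A + 2 * ε ^ 2) B (vieteRoot (A + 2 * ε ^ 2) B) := by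
  have hA := nonneg_of_sq_le_cube hAB
  refine isRootTriple_vieteRoot (hAB.trans ?_)
  gcongr
  exact le_add_of_nonneg_right (by positivity)

theorem norm_quad_le {d : Fin 3 → E} {x X : ℝ} (hx : |x| ≤ X) :
    ‖quad d x‖ ≤ (1 + X + X ^ 2) * ‖d‖ := by
  have hX : 0 ≤ X := (abs_nonneg x).trans hx
  have hterm (j : Fin 3) : ‖x ^ (j : ℕ) • d j‖ ≤ X ^ (j : ℕ) * ‖d‖ := by
    rw [norm_smul, norm_pow, Real.norm_eq_abs]
    gcongr
    exact norm_le_pi_norm d j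
  calc ‖quad d x‖ ≤ ∑ j : Fin 3, X ^ (j : ℕ) * ‖d‖ := norm_sum_le_of_le _ fun j _ => hterm j
    _ = (1 + X + X ^ 2) * ‖d‖ := by
      rw [← Finset.sum_mul, Fin.sum_univ_three, Fin.val_zero, Fin.val_one, Fin.val_two, pow_zero,
        pow_one]

variable {A B : ℝ → ℝ} {d : ℝ → Fin 3 → E} {l u : ℝ}

theorem continuousOn_perturbedResidue {s : Set ℝ} {ε : ℝ} (hA : ContinuousOn A s)
    (hB : ContinuousOn B s) (hd : ContinuousOn d s) (hAB : ∀ t ∈ s, B t ^ 2 ≤ A t ^ 3)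
    (hε : 0 < ε) : ContinuousOn (perturbedResidue A B d ε) s := by
  have hshift : ContinuousOn (fun t => A t + 2 * ε ^ 2) s := hA.add continuousOn_const
  unfold perturbedResidue residueSum
  refine continuousOn_finsetSum _ fun k _ => ?_
  have hroot := continuousOn_vieteRoot hshift hB
    (fun t ht => add_pos_of_nonneg_of_pos (nonneg_of_sq_le_cube (hAB t ht)) (by positivity)) k
  refine ContinuousOn.div (continuousOn_finsetSum _ fun j _ => ?_).norm
    (continuousOn_const.mul ((hroot.pow 2).sub hshift)).abs fun t ht => ?_
  · exact (hroot.pow j).smul (continuousOn_pi.mp hd j)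
  · have hderiv := ((isRootTriple_vieteRoot_perturbed (hAB t ht) ε).deriv_ge_of_perturbed
      (hAB t ht) k).1
    exact ((by positivity : 0 < 6 * ε ^ 2).trans_le hderiv).ne'

theorem exists_perturbedResidue_le {s : Set ℝ} (hs : IsCompact s) (hA : ContinuousOn A s)
    (hd : ContinuousOn d s) (hAB : ∀ t ∈ s, B t ^ 2 ≤ A t ^ 3) (ε₀ : ℝ) :
    ∃ C ≥ 0, ∀ ε ∈ Ioc 0 ε₀, ∀ t ∈ s, perturbedResidue A B d ε t ≤ C / ε ^ 2 := by
  obtain ⟨M, hM⟩ := hs.exists_bound_of_continuousOn hd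
  obtain ⟨N, hN⟩ := hs.exists_bound_of_continuousOn hA
  set X := √(4 * (N + 2 * ε₀ ^ 2))
  refine ⟨3 * ((1 + X + X ^ 2) * |M|), by positivity, fun ε ⟨hε, hε₀⟩ t ht => ?_⟩
  have hx := isRootTriple_vieteRoot_perturbed (hAB t ht) ε
  have hterm (k : Fin 3) : ‖quad (d t) (vieteRoot (A t + 2 * ε ^ 2) (B t) k)‖ /
      |3 * (vieteRoot (A t + 2 * ε ^ 2) (B t) k ^ 2 - (A t + 2 * ε ^ 2))| ≤
        (1 + X + X ^ 2) * |M| / ε ^ 2 := by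
    have hroot : |vieteRoot (A t + 2 * ε ^ 2) (B t) k| ≤ X := by
      refine Real.abs_le_sqrt ((hx.sq_le k).trans ?_)
      gcongr
      exact (le_abs_self _).trans (hN t ht)
    gcongr
    · exact (norm_quad_le hroot).trans (by gcongr; exact (hM t ht).trans (le_abs_self M))
    · linarith [(hx.deriv_ge_of_perturbed (hAB t ht) k).1, sq_nonneg ε]
  unfold perturbedResidue residueSum
  calc _ ≤ ∑ _k : Fin 3, (1 + X + X ^ 2) * |M| / ε ^ 2 := Finset.sum_le_sum fun k _ => hterm k
    _ = 3 * ((1 + X + X ^ 2) * |M|) / ε ^ 2 := by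
      rw [Finset.sum_const, Finset.card_univ, Fintype.card_fin, nsmul_eq_mul, Nat.cast_ofNat,
        mul_div_assoc 3]

theorem HasPointwiseBound.perturbedResidue_le {I : Set ℝ} {S : Finset ℝ} {K ε t : ℝ}
    (hS : HasPointwiseBound A B d I S K) (ht : t ∈ I) (htS : t ∉ S) (hAB : B t ^ 2 ≤ A t ^ 3)
    (hdisc : A t ^ 3 ≠ B t ^ 2) (hε : 0 < ε) :
    perturbedResidue A B d ε t ≤ 45 * K * (∏ s ∈ S, |t - s|)⁻¹ := by
  have hx := isRootTriple_vieteRoot hAB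
  have hprod : 0 < ∏ s ∈ S, |t - s| := Finset.prod_pos fun s hs =>
    abs_pos.mpr (sub_ne_zero.mpr fun h => htS (h ▸ hs))
  have hterm (k : Fin 3) : ‖quad (d t) (vieteRoot (A t) (B t) k)‖ /
      |3 * (vieteRoot (A t) (B t) k ^ 2 - A t)| ≤ K * (∏ s ∈ S, |t - s|)⁻¹ := by
    rw [← div_eq_mul_inv, div_le_div_iff₀ (abs_pos.mpr (hx.deriv_ne_zero hdisc k)) hprod, mul_comm]
    exact hS t ht _ hx k
  calc perturbedResidue A B d ε t
      ≤ 15 * residueSum (d t) (A t) (vieteRoot (A t) (B t)) :=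
        residueSum_perturbed_le hx hdisc hε (isRootTriple_vieteRoot_perturbed hAB ε) (d t)
    _ ≤ 15 * ∑ _k : Fin 3, K * (∏ s ∈ S, |t - s|)⁻¹ := by
        gcongr
        exact Finset.sum_le_sum fun k _ => hterm k
    _ = 45 * K * (∏ s ∈ S, |t - s|)⁻¹ := by
        rw [Finset.sum_const, Finset.card_univ, Fintype.card_fin, nsmul_eq_mul]; push_cast; ring

theorem HasPointwiseBound.hasLogBound {S : Finset ℝ} {K ε₀ : ℝ}
    (hS : HasPointwiseBound A B d (Icc l u) S K) (hlu : l ≤ u) (hK : 0 ≤ K) (hε₀ : 0 < ε₀)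
    (hA : ContinuousOn A (Icc l u)) (hB : ContinuousOn B (Icc l u)) (hd : ContinuousOn d (Icc l u))
    (hAB : ∀ t ∈ Icc l u, B t ^ 2 ≤ A t ^ 3) (hfin : {t ∈ Icc l u | A t ^ 3 = B t ^ 2}.Finite) :
    HasLogBound A B d l u ε₀ := by
  obtain ⟨C, hC, hnear⟩ := exists_perturbedResidue_le isCompact_Icc hA hd hAB ε₀
  have hint : ∀ ε ∈ Ioc 0 ε₀, IntervalIntegrable (perturbedResidue A B d ε) volume l u :=
    fun ε hε => ContinuousOn.intervalIntegrable <| by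
      rw [uIcc_of_le hlu]
      exact continuousOn_perturbedResidue hA hB hd hAB hε.1
  obtain ⟨M, hM, hlog⟩ := exists_integral_le_log (C := C + 45 * K) (S := S) hlu (by positivity) hε₀
    hint (fun ε hε t ht => (hnear ε hε t ht).trans (by
      gcongr
      exact le_add_of_nonneg_right (by positivity))) fun ε hε => by
      filter_upwards [(hfin.union S.finite_toSet).countable.ae_notMem volume] with t htZ ht
      rw [mem_union, not_or, Finset.mem_coe] at htZ
      refine (hS.perturbedResidue_le ht htZ.2 (hAB t ht) (fun h => htZ.1 ⟨ht, h⟩) hε.1).trans ?_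
      gcongr
      exact le_add_of_nonneg_left hC
  exact ⟨M, hM, fun ε hε => ⟨hint ε hε, hlog ε hε⟩⟩

end PointwiseToLogarithmic

section AnnulusIntegrals

open Filter Topology Asymptotics

theorem exists_Icc_subset_annulus {l u z ρ : ℝ} (hz : z ∈ Icc l u) (hρ : 0 ≤ ρ)
    (hρu : 4 * ρ ≤ u - l) :
    ∃ p ≥ l, p + ρ ≤ u ∧ ∀ t ∈ Icc p (p + ρ), ρ ≤ |t - z| ∧ |t - z| ≤ 2 * ρ := by
  rcases le_total (z - l) (u - z) with hleft | hright
  · refine ⟨z + ρ, by linarith [hz.1], by linarith, fun t ⟨htl, htu⟩ => ?_⟩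
    rw [abs_of_nonneg (by linarith)]
    constructor <;> linarith
  · refine ⟨z - 2 * ρ, by linarith, by linarith [hz.2], fun t ⟨htl, htu⟩ => ?_⟩
    rw [abs_of_nonpos (by linarith)]
    constructor <;> linarith

theorem mul_le_integral_of_le_on_annulus {l u z ρ m : ℝ} {f : ℝ → ℝ} (hz : z ∈ Icc l u)
    (hρ : 0 ≤ ρ) (hρu : 4 * ρ ≤ u - l) (hf : ∀ t, 0 ≤ f t) (hint : IntervalIntegrable f volume l u)
    (hm : ∀ t ∈ Icc l u, ρ ≤ |t - z| → |t - z| ≤ 2 * ρ → m ≤ f t) :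
    ρ * m ≤ ∫ t in l..u, f t := by
  obtain ⟨p, hlp, hpu, hannulus⟩ := exists_Icc_subset_annulus hz hρ hρu
  have hpρ : p ≤ p + ρ := le_add_of_nonneg_right hρ
  have hsub : Icc p (p + ρ) ⊆ Icc l u := Icc_subset_Icc hlp hpu
  calc ρ * m = ∫ _t in p..(p + ρ), m := by
        rw [intervalIntegral.integral_const, add_sub_cancel_left, smul_eq_mul]
    _ ≤ ∫ t in p..(p + ρ), f t := by
        refine intervalIntegral.integral_mono_on hpρ intervalIntegrable_const (hint.mono_set ?_)
          fun t ht => hm t (hsub ht) (hannulus t ht).1 (hannulus t ht).2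
        rwa [uIcc_of_le hpρ, uIcc_of_le (hlp.trans (hpρ.trans hpu))]
    _ ≤ ∫ t in l..u, f t :=
        intervalIntegral.integral_mono_interval hlp hpρ hpu (Eventually.of_forall hf) hint

theorem isLittleO_log_one_add_mul_pow {a : ℝ} (ha : 0 ≤ a) (m : ℕ) :
    (fun y : ℝ => Real.log (1 + a * y ^ m)) =o[atTop] (id : ℝ → ℝ) := by
  have hconst : (fun _ : ℝ => Real.log (1 + a)) =o[atTop] (id : ℝ → ℝ) :=
    isLittleO_const_id_atTop _
  refine IsBigO.trans_isLittleO (IsBigO.of_bound' ?_)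
    (hconst.add (Real.isLittleO_log_id_atTop.const_mul_left (m : ℝ)))
  filter_upwards [eventually_ge_atTop 1] with y hy
  have hpow : 1 ≤ y ^ m := one_le_pow₀ hy
  have hlog : Real.log (1 + a * y ^ m) ≤ Real.log (1 + a) + m * Real.log y := by
    rw [← Real.log_pow, ← Real.log_mul (by positivity) (by positivity)]
    exact Real.log_le_log (by positivity) (by linarith)
  rw [Real.norm_of_nonneg (Real.log_nonneg (le_add_of_nonneg_right (by positivity)))]
  exact hlog.trans (le_abs_self _)

theorem sqrt_mul_le_integral_of_le_cube_mul_sq {l u z c y : ℝ} {f : ℝ → ℝ} (hz : z ∈ Icc l u)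
    (hc : 0 < c) (hy : 0 < y) (hyu : 4 * (y ^ 2)⁻¹ ≤ u - l) (hf : ∀ t, 0 ≤ f t)
    (hint : IntervalIntegrable f volume l u)
    (hlow : ∀ t ∈ Icc l u, (y ^ 2)⁻¹ ≤ |t - z| → |t - z| ≤ 2 * (y ^ 2)⁻¹ →
      c ≤ |t - z| ^ 3 * f t ^ 2) :
    √(c / 8) * y ≤ ∫ t in l..u, f t := by
  have hannulus : ∀ t ∈ Icc l u, (y ^ 2)⁻¹ ≤ |t - z| → |t - z| ≤ 2 * (y ^ 2)⁻¹ →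
      √(c / 8) * y ^ 3 ≤ f t := by
    intro t ht htl htu
    refine le_of_sq_le_sq ?_ (hf t)
    have hle : c ≤ (2 * (y ^ 2)⁻¹) ^ 3 * f t ^ 2 := (hlow t ht htl htu).trans (by gcongr)
    calc (√(c / 8) * y ^ 3) ^ 2 = c / 8 * y ^ 6 := by
          rw [mul_pow, Real.sq_sqrt (by positivity)]; ring
      _ ≤ (2 * (y ^ 2)⁻¹) ^ 3 * f t ^ 2 / 8 * y ^ 6 := by gcongr
      _ = f t ^ 2 := by field_simp; ring
  calc √(c / 8) * y = (y ^ 2)⁻¹ * (√(c / 8) * y ^ 3) := by field_simp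
    _ ≤ ∫ t in l..u, f t :=
      mul_le_integral_of_le_on_annulus hz (by positivity) hyu hf hint hannulus

/- With `ε = c' y ^ (-2 n)`, the annulus of radius `y⁻²` about `z` contributes at least a multiple
of `y` to the integral of `f ε`, whereas `log (1 + ε⁻¹)` is `o(y)`. -/
theorem not_eventually_le_cube_mul_sq {l u z c c' K ε₀ : ℝ} {n : ℕ} {f : ℝ → ℝ → ℝ} (hlu : l < u)
    (hz : z ∈ Icc l u) (hc : 0 < c) (hc' : 0 < c') (hn : n ≠ 0) (hε₀ : 0 < ε₀)
    (hf : ∀ ε t, 0 ≤ f ε t)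
    (hlog : ∀ ε ∈ Ioc 0 ε₀, IntervalIntegrable (f ε) volume l u ∧
      ∫ t in l..u, f ε t ≤ K * Real.log (1 + ε⁻¹)) :
    ¬ ∀ᶠ t in 𝓝[Icc l u] z, ∀ ε ∈ Ioc 0 ε₀, ε ≤ c' * |t - z| ^ n →
      c ≤ |t - z| ^ 3 * f ε t ^ 2 := by
  intro hlow
  obtain ⟨η, hη, hball⟩ := Metric.mem_nhdsWithin_iff.mp hlow
  have hρ_lim : Tendsto (fun y : ℝ => (y ^ 2)⁻¹) atTop (𝓝 0) :=
    tendsto_inv_atTop_zero.comp (tendsto_pow_atTop two_ne_zero)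
  have hε_lim : Tendsto (fun y : ℝ => c' * ((y ^ 2)⁻¹) ^ n) atTop (𝓝 0) := by
    simpa only [zero_pow hn, mul_zero] using (hρ_lim.pow n).const_mul c'
  have hlog_lim := ((isLittleO_log_one_add_mul_pow (inv_nonneg.mpr hc'.le) (2 * n)).const_mul_left
    K).bound (half_pos (Real.sqrt_pos.mpr (by positivity : 0 < c / 8)))
  obtain ⟨y, hy, hρ_len, hρ_η, hε_le, hgrowth⟩ := ((eventually_gt_atTop 0).and <|
    (hρ_lim.eventually_lt_const (by linarith : 0 < (u - l) / 4)).and <|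
    (hρ_lim.eventually_lt_const (half_pos hη)).and <|
    (hε_lim.eventually_lt_const hε₀).and hlog_lim).exists
  set ε := c' * ((y ^ 2)⁻¹) ^ n with hε
  obtain ⟨hint, hint_le⟩ := hlog ε ⟨by positivity, hε_le.le⟩
  have hle := sqrt_mul_le_integral_of_le_cube_mul_sq hz hc hy (by linarith) (hf ε) hint
    fun t ht htl htu => hball ⟨by rw [Metric.mem_ball, Real.dist_eq]; linarith, ht⟩ ε
      ⟨by positivity, hε_le.le⟩ (by rw [hε]; gcongr)
  have hlog_eq : Real.log (1 + ε⁻¹) = Real.log (1 + c'⁻¹ * y ^ (2 * n)) := by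
    rw [hε, mul_inv, inv_pow, inv_inv, ← pow_mul]
  rw [id, Real.norm_of_nonneg hy.le, Real.norm_eq_abs, ← hlog_eq] at hgrowth
  have hpos : 0 < √(c / 8) * y := by positivity
  linarith [le_abs_self (K * Real.log (1 + ε⁻¹))]

end AnnulusIntegrals

section Singularities

open Filter Topology

variable {𝕜 : Type*} [NontriviallyNormedField 𝕜]

theorem exists_eventually_pow_mul_le_or_le {F : 𝕜 → 𝕜} {z : 𝕜} (hF : MeromorphicAt F z) (m : ℕ) :
    (∃ M, ∀ᶠ t in 𝓝[≠] z, ‖(t - z) ^ m * F t‖ ≤ M) ∨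
      ∃ c > 0, ∀ᶠ t in 𝓝[≠] z, c ≤ ‖(t - z) ^ (m + 1) * F t‖ := by
  have hbdd {G : 𝕜 → 𝕜} (hG : MeromorphicAt G z) (ho : 0 ≤ meromorphicOrderAt G z) :
      ∃ M > 0, ∀ᶠ t in 𝓝[≠] z, ‖G t‖ ≤ M := by
    obtain ⟨v, hv⟩ := tendsto_nhds_of_meromorphicOrderAt_nonneg hG ho
    exact ⟨‖v‖ + 1, by positivity, (hv.norm.eventually_lt_const (lt_add_one _)).mono
      fun _ h => h.le⟩
  have hsub : MeromorphicAt (fun t => t - z) z := by fun_prop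
  have hpow : MeromorphicAt (fun t => (t - z) ^ m * F t) z := (hsub.pow m).mul hF
  rcases le_or_gt 0 (meromorphicOrderAt (fun t => (t - z) ^ m * F t) z) with ho | ho
  · exact .inl ((hbdd hpow ho).imp fun _ h => h.2)
  have hne := (hpow.eventually_eq_zero_or_eventually_ne_zero).resolve_left fun h =>
    absurd (meromorphicOrderAt_eq_top_iff.mpr h) (ne_top_of_lt ho)
  have hsucc : 0 ≤ meromorphicOrderAt (fun t => (t - z) * ((t - z) ^ m * F t))⁻¹ z := by
    rw [meromorphicOrderAt_inv, fun_meromorphicOrderAt_mul hsub hpow,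
      meromorphicOrderAt_id_sub_const]
    lift meromorphicOrderAt (fun t => (t - z) ^ m * F t) z to ℤ using ne_top_of_lt ho with o
    norm_cast at ho ⊢
    omega
  obtain ⟨M, hM, hle⟩ := hbdd (hsub.mul hpow).inv hsucc
  refine .inr ⟨M⁻¹, inv_pos.mpr hM, ?_⟩
  filter_upwards [hle, hne, self_mem_nhdsWithin] with t ht htne htz
  have hpos : 0 < ‖(t - z) * ((t - z) ^ m * F t)‖ :=
    norm_pos_iff.mpr (mul_ne_zero (sub_ne_zero.mpr htz) htne)
  rw [pow_succ', mul_assoc]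
  refine inv_le_of_inv_le₀ hpos ?_
  simpa only [Pi.inv_apply, Pi.mul_apply, norm_inv] using ht

theorem exists_eventually_pow_le_norm {g : 𝕜 → 𝕜} {z : 𝕜} (hg : MeromorphicAt g z)
    (hne : ∀ᶠ t in 𝓝[≠] z, g t ≠ 0) :
    ∃ n ≠ 0, ∃ c > 0, ∀ᶠ t in 𝓝[≠] z, c * ‖t - z‖ ^ n ≤ ‖g t‖ := by
  obtain ⟨n, hn⟩ := hg.inv
  have hcont : ContinuousAt (fun t => (t - z) ^ (n + 1) * (g t)⁻¹) z := by
    have hsub : ContinuousAt (fun t => t - z) z := by fun_prop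
    refine (hsub.mul hn.continuousAt).congr (.of_forall fun t => ?_)
    simp only [pow_succ', mul_assoc, smul_eq_mul, Pi.inv_apply, Pi.mul_apply]
  refine ⟨n + 1, n.succ_ne_zero, 1, one_pos, ?_⟩
  have hlt := hcont.norm.eventually_lt_const (u := 1) (by simp)
  filter_upwards [nhdsWithin_le_nhds hlt, hne] with t ht htne
  rw [norm_mul, norm_pow, norm_inv, ← div_eq_mul_inv, div_lt_one (norm_pos_iff.mpr htne)] at ht
  rw [one_mul]
  exact ht.le

end Singularities

section LogBoundToPointwise

open Filter Topology
open scoped InnerProductSpace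

variable {E : Type*} [NormedAddCommGroup E]

section NormedSpace

variable [NormedSpace ℝ E] {A B : ℝ → ℝ} {d : ℝ → Fin 3 → E} {I : Set ℝ}

theorem HasPointwiseBound.mono_finset {S S' : Finset ℝ} {K : ℝ}
    (h : HasPointwiseBound A B d I S K) (hK : 0 ≤ K) (hI : Bornology.IsBounded I) (hSS' : S ⊆ S') :
    ∃ K' ≥ 0, HasPointwiseBound A B d I S' K' := by
  have hcont : Continuous fun t : ℝ => ∏ s ∈ S' \ S, |t - s| := by fun_prop
  obtain ⟨C, hC⟩ := hI.isCompact_closure.exists_bound_of_continuousOn hcont.continuousOn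
  refine ⟨|C| * K, by positivity, fun t ht x hx k => ?_⟩
  have hle : ∏ s ∈ S' \ S, |t - s| ≤ |C| :=
    (le_abs_self _).trans ((hC t (subset_closure ht)).trans (le_abs_self C))
  rw [← Finset.prod_sdiff hSS', mul_assoc, mul_assoc]
  exact mul_le_mul hle (h t ht x hx k) (by positivity) (abs_nonneg C)

theorem exists_hasPointwiseBound_of_local (hI : IsCompact I)
    (h : ∀ z ∈ I, ∃ U ∈ 𝓝[I] z, ∃ K ≥ 0, HasPointwiseBound A B d (U ∩ I) {z} K) :
    ∃ S : Finset ℝ, (S : Set ℝ) ⊆ I ∧ ∃ K ≥ 0, HasPointwiseBound A B d I S K := by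
  suffices hinter : ∃ S : Finset ℝ, (S : Set ℝ) ⊆ I ∧ ∃ K ≥ 0,
      HasPointwiseBound A B d (I ∩ I) S K by
    rwa [inter_self] at hinter
  refine hI.induction_on (p := fun V => ∃ S : Finset ℝ, (S : Set ℝ) ⊆ I ∧ ∃ K ≥ 0,
    HasPointwiseBound A B d (V ∩ I) S K) ?_ ?_ ?_ ?_
  · exact ⟨∅, by simp, 0, le_rfl, fun t ht => absurd ht.1 (notMem_empty t)⟩
  · rintro V W hVW ⟨S, hSI, K, hK, hS⟩
    exact ⟨S, hSI, K, hK, fun t ht => hS t ⟨hVW ht.1, ht.2⟩⟩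
  · rintro V W ⟨S, hSI, K, hK, hS⟩ ⟨S', hSI', K', hK', hS'⟩
    obtain ⟨N, hN, hV⟩ := hS.mono_finset hK (hI.isBounded.subset inter_subset_right)
      Finset.subset_union_left
    obtain ⟨N', -, hW⟩ := hS'.mono_finset hK' (hI.isBounded.subset inter_subset_right)
      Finset.subset_union_right
    refine ⟨S ∪ S', by simp [hSI, hSI'], max N N', le_max_of_le_left hN, ?_⟩
    rintro t ⟨htV | htW, htI⟩ x hx k
    · exact (hV t ⟨htV, htI⟩ x hx k).trans (by gcongr; exact le_max_left N N')
    · exact (hW t ⟨htW, htI⟩ x hx k).trans (by gcongr; exact le_max_right N N')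
  · intro z hz
    obtain ⟨U, hU, K, hK, hzU⟩ := h z hz
    exact ⟨U, hU, {z}, by simpa using hz, K, hK, hzU⟩

end NormedSpace

variable [InnerProductSpace ℝ E]

theorem IsRootTriple.sq_residue_le {A B : ℝ} {s : Fin 3 → ℝ} (hs : IsRootTriple A B s)
    (hAB : A ^ 3 ≠ B ^ 2) (d : Fin 3 → E) (k : Fin 3) :
    (‖quad d (s k)‖ / |3 * (s k ^ 2 - A)|) ^ 2 ≤ residueForm A B d / (6 * (A ^ 3 - B ^ 2)) := by
  rw [← hs.sum_sq_residue_eq hAB d]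
  exact Finset.single_le_sum (f := fun k => (‖quad d (s k)‖ / |3 * (s k ^ 2 - A)|) ^ 2)
    (fun _ _ => sq_nonneg _) (Finset.mem_univ k)

theorem IsRootTriple.residueForm_div_le_sq_residueSum {A B : ℝ} {s : Fin 3 → ℝ}
    (hs : IsRootTriple A B s) (hAB : A ^ 3 ≠ B ^ 2) (d : Fin 3 → E) :
    residueForm A B d / (6 * (A ^ 3 - B ^ 2)) ≤ residueSum d A s ^ 2 := by
  rw [← hs.sum_sq_residue_eq hAB d]
  exact Finset.sum_sq_le_sq_sum_of_nonneg fun _ _ => by positivity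

theorem residueForm_div_nonneg {A B : ℝ} (hAB : B ^ 2 ≤ A ^ 3) (hne : A ^ 3 ≠ B ^ 2)
    (d : Fin 3 → E) : 0 ≤ residueForm A B d / (6 * (A ^ 3 - B ^ 2)) :=
  (sq_nonneg _).trans ((isRootTriple_vieteRoot hAB).sq_residue_le hne d 0)

theorem analyticAt_residueForm {A B : ℝ → ℝ} {d : ℝ → Fin 3 → E} {z : ℝ} (hA : AnalyticAt ℝ A z)
    (hB : AnalyticAt ℝ B z) (hd : AnalyticAt ℝ d z) :
    AnalyticAt ℝ (fun t => residueForm (A t) (B t) (d t)) z := by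
  have hinner (i j : Fin 3) : AnalyticAt ℝ (fun t => ⟪d t i, d t j⟫_ℝ) z :=
    ((innerSL ℝ).analyticAt_bilinear (d z i, d z j)).comp₂
      (analyticAt_pi_iff.mp hd i) (analyticAt_pi_iff.mp hd j)
  unfold residueForm
  fun_prop

variable {A B : ℝ → ℝ} {d : ℝ → Fin 3 → E} {l u ε₀ z : ℝ}

theorem residueForm_div_le_sq_perturbedResidue {N ε t : ℝ} (hAB : B t ^ 2 ≤ A t ^ 3)
    (hne : A t ^ 3 ≠ B t ^ 2) (hN : A t ≤ N) (hε : 0 < ε) (hε1 : ε ≤ 1)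
    (hsmall : N ^ 2 * ε ≤ A t ^ 3 - B t ^ 2) :
    residueForm (A t) (B t) (d t) / (6 * (A t ^ 3 - B t ^ 2)) ≤
      (3 * (8 + 6 * √(4 * N))) ^ 2 * perturbedResidue A B d ε t ^ 2 := by
  have hs := isRootTriple_vieteRoot hAB
  have hA : 0 < A t := (nonneg_of_sq_le_cube hAB).lt_of_ne' fun h =>
    hne (by rw [h] at hAB ⊢; linarith [sq_nonneg (B t)])
  have hN_pos : 0 < N := hA.trans_le hN
  have hderiv (k : Fin 3) : ε ≤ |3 * (vieteRoot (A t) (B t) k ^ 2 - A t)| := by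
    refine le_of_mul_le_mul_left ?_ (by positivity : 0 < N ^ 2)
    exact hsmall.trans ((hs.sub_le_deriv k).trans (by gcongr))
  have hroot (k : Fin 3) : |vieteRoot (A t) (B t) k| ≤ √(4 * N) :=
    Real.abs_le_sqrt ((hs.sq_le k).trans (by gcongr))
  rw [← mul_pow]
  exact (hs.residueForm_div_le_sq_residueSum hne (d t)).trans (pow_le_pow_left₀
    (residueSum_nonneg _ _ _) (residueSum_le_perturbed hs hε hε1
      (isRootTriple_vieteRoot_perturbed hAB ε) hroot hderiv (d t)) 2)

theorem exists_eventually_le_cube_mul_sq_perturbedResidue {I : Set ℝ} {c c' : ℝ} {n : ℕ}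
    (hn : n ≠ 0) (hc' : 0 < c') (hA : ContinuousAt A z) (hAB : ∀ t ∈ I, B t ^ 2 ≤ A t ^ 3)
    (hne : ∀ᶠ t in 𝓝[≠] z, A t ^ 3 ≠ B t ^ 2)
    (hdisc : ∀ᶠ t in 𝓝[≠] z, c' * ‖t - z‖ ^ n ≤ ‖A t ^ 3 - B t ^ 2‖)
    (hform : ∀ᶠ t in 𝓝[≠] z, c ≤
      ‖(t - z) ^ 3 * (residueForm (A t) (B t) (d t) / (6 * (A t ^ 3 - B t ^ 2)))‖) :
    ∃ C > 0, ∃ c'' > 0, ∀ᶠ t in 𝓝[I] z, ∀ ε ∈ Ioc 0 1, ε ≤ c'' * |t - z| ^ n →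
      c / C ≤ |t - z| ^ 3 * perturbedResidue A B d ε t ^ 2 := by
  set N := |A z| + 1
  have hN : ∀ᶠ t in 𝓝 z, A t < N :=
    hA.eventually_lt_const ((le_abs_self _).trans_lt (lt_add_one _))
  have hN_pos : 0 < N := by positivity
  refine ⟨(3 * (8 + 6 * √(4 * N))) ^ 2, by positivity, c' / N ^ 2, by positivity, ?_⟩
  filter_upwards [self_mem_nhdsWithin, nhdsWithin_le_nhds hN,
    nhdsWithin_le_nhds (eventually_nhdsWithin_iff.mp (hform.and (hdisc.and hne)))]
    with t ht hAN hpunctured ε ⟨hε, hε1⟩ hε_le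
  have htz : t ≠ z := by
    rintro rfl
    rw [sub_self, abs_zero, zero_pow hn, mul_zero] at hε_le
    exact hε_le.not_gt hε
  obtain ⟨hform_t, hdisc_t, hne_t⟩ := hpunctured htz
  rw [norm_mul, norm_pow, Real.norm_eq_abs, Real.norm_eq_abs,
    abs_of_nonneg (residueForm_div_nonneg (hAB t ht) hne_t _)] at hform_t
  rw [Real.norm_eq_abs, Real.norm_of_nonneg (sub_nonneg.mpr (hAB t ht))] at hdisc_t
  have hsmall : N ^ 2 * ε ≤ A t ^ 3 - B t ^ 2 := by
    calc N ^ 2 * ε ≤ N ^ 2 * (c' / N ^ 2 * |t - z| ^ n) := by gcongr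
      _ = c' * |t - z| ^ n := by field_simp [hN_pos.ne']
      _ ≤ A t ^ 3 - B t ^ 2 := hdisc_t
  have hresidue :=
    residueForm_div_le_sq_perturbedResidue (d := d) (hAB t ht) hne_t hAN.le hε hε1 hsmall
  rw [div_le_iff₀' (by positivity), mul_left_comm]
  exact hform_t.trans (by gcongr)

/- A pole of order at least three of the sum of the squared residues would make the perturbed
residues too large for the logarithmic bound. -/
theorem HasLogBound.exists_eventually_sq_mul_residueForm_div_le (h : HasLogBound A B d l u ε₀)
    (hlu : l < u) (hε₀ : 0 < ε₀) (hz : z ∈ Icc l u) (hA : AnalyticAt ℝ A z)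
    (hB : AnalyticAt ℝ B z) (hd : AnalyticAt ℝ d z) (hAB : ∀ t ∈ Icc l u, B t ^ 2 ≤ A t ^ 3)
    (hne : ∀ᶠ t in 𝓝[≠] z, A t ^ 3 ≠ B t ^ 2) :
    ∃ M, ∀ᶠ t in 𝓝[≠] z,
      ‖(t - z) ^ 2 * (residueForm (A t) (B t) (d t) / (6 * (A t ^ 3 - B t ^ 2)))‖ ≤ M := by
  have hdisc : AnalyticAt ℝ (fun t => A t ^ 3 - B t ^ 2) z := by fun_prop
  have hF : MeromorphicAt
      (fun t => residueForm (A t) (B t) (d t) / (6 * (A t ^ 3 - B t ^ 2))) z :=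
    (analyticAt_residueForm hA hB hd).meromorphicAt.fun_div
      (analyticAt_const.mul hdisc).meromorphicAt
  refine (exists_eventually_pow_mul_le_or_le hF 2).resolve_right ?_
  rintro ⟨c, hc, hform_low⟩
  obtain ⟨n, hn, c', hc', hdisc_low⟩ := exists_eventually_pow_le_norm hdisc.meromorphicAt
    (hne.mono fun _ h => sub_ne_zero.mpr h)
  obtain ⟨C, hC, c'', hc'', hlow⟩ := exists_eventually_le_cube_mul_sq_perturbedResidue hn hc'
    hA.continuousAt hAB hne hdisc_low hform_low
  obtain ⟨K, -, hlog⟩ := h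
  exact not_eventually_le_cube_mul_sq hlu hz (div_pos hc hC) hc'' hn (lt_min hε₀ one_pos)
    (perturbedResidue_nonneg A B d) (fun ε hε => hlog ε ⟨hε.1, hε.2.trans (min_le_left _ _)⟩)
    (hlow.mono fun t ht ε hε => ht ε ⟨hε.1, hε.2.trans (min_le_right _ _)⟩)

theorem HasLogBound.exists_local_hasPointwiseBound (h : HasLogBound A B d l u ε₀) (hlu : l < u)
    (hε₀ : 0 < ε₀) (hz : z ∈ Icc l u) (hA : AnalyticAt ℝ A z) (hB : AnalyticAt ℝ B z)
    (hd : AnalyticAt ℝ d z) (hAB : ∀ t ∈ Icc l u, B t ^ 2 ≤ A t ^ 3)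
    (hne : ∀ᶠ t in 𝓝[≠] z, A t ^ 3 ≠ B t ^ 2) :
    ∃ U ∈ 𝓝[Icc l u] z, ∃ K ≥ 0, HasPointwiseBound A B d (U ∩ Icc l u) {z} K := by
  obtain ⟨M, hM⟩ := h.exists_eventually_sq_mul_residueForm_div_le hlu hε₀ hz hA hB hd hAB hne
  refine ⟨_, nhdsWithin_le_nhds (eventually_nhdsWithin_iff.mp (hM.and hne)), √M, by positivity,
    fun t ⟨hpunctured, _⟩ x hx k => ?_⟩
  rw [Finset.prod_singleton]
  rcases eq_or_ne t z with rfl | htz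
  · rw [sub_self, abs_zero, zero_mul]
    positivity
  obtain ⟨hM_t, hne_t⟩ := hpunctured htz
  have hderiv : 0 < |3 * (x k ^ 2 - A t)| := abs_pos.mpr (hx.deriv_ne_zero hne_t k)
  rw [← div_le_iff₀ hderiv, mul_div_assoc]
  refine Real.le_sqrt_of_sq_le ?_
  calc (|t - z| * (‖quad (d t) (x k)‖ / |3 * (x k ^ 2 - A t)|)) ^ 2
      = (t - z) ^ 2 * (‖quad (d t) (x k)‖ / |3 * (x k ^ 2 - A t)|) ^ 2 := by
        rw [mul_pow, sq_abs]
    _ ≤ (t - z) ^ 2 * (residueForm (A t) (B t) (d t) / (6 * (A t ^ 3 - B t ^ 2))) := by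
        gcongr
        exact hx.sq_residue_le hne_t (d t) k
    _ ≤ M := (Real.le_norm_self _).trans hM_t

theorem HasLogBound.exists_hasPointwiseBound (h : HasLogBound A B d l u ε₀) (hlu : l < u)
    (hε₀ : 0 < ε₀) (hA : AnalyticOnNhd ℝ A (Icc l u)) (hB : AnalyticOnNhd ℝ B (Icc l u))
    (hd : AnalyticOnNhd ℝ d (Icc l u)) (hAB : ∀ t ∈ Icc l u, B t ^ 2 ≤ A t ^ 3)
    (hne : ∀ z ∈ Icc l u, ∀ᶠ t in 𝓝[≠] z, A t ^ 3 ≠ B t ^ 2) :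
    ∃ S : Finset ℝ, (S : Set ℝ) ⊆ Icc l u ∧ ∃ K ≥ 0, HasPointwiseBound A B d (Icc l u) S K :=
  exists_hasPointwiseBound_of_local isCompact_Icc fun z hz =>
    h.exists_local_hasPointwiseBound hlu hε₀ hz (hA z hz) (hB z hz) (hd z hz) hAB (hne z hz)

end LogBoundToPointwise

section Roots

theorem map_orderedRoot {p : ℝ[X]} {n : ℕ} (hn : p.roots.card = n) :
    Finset.univ.val.map (fun j : Fin n => orderedRoot p j) = p.roots := by
  have hlen : (p.roots.sort (· ≤ ·)).length = n := by rw [Multiset.length_sort, hn]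
  have hlist : List.ofFn (fun j : Fin n => orderedRoot p j) = p.roots.sort (· ≤ ·) :=
    List.ext_getElem (by rw [List.length_ofFn, hlen]) fun i _ hi => by
      rw [List.getElem_ofFn, orderedRoot, List.getD_eq_getElem _ _ hi]
  rw [Fin.univ_val_map, hlist, Multiset.sort_eq]

theorem roots_prod_X_sub_C_comp {R ι : Type*} [CommRing R] [IsDomain R] [Fintype ι] (y : ι → R) :
    (∏ k, (X - C (y k))).roots = Finset.univ.val.map y := by
  simpa only [Multiset.map_map] using! roots_multiset_prod_X_sub_C (Finset.univ.val.map y)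

theorem orderedRoot_prod_X_sub_C {n : ℕ} (y : Fin n → ℝ) (j : Fin n) :
    orderedRoot (∏ k, (X - C (y k))) j = y (Tuple.sort y j) := by
  have hsort : (∏ k, (X - C (y k))).roots.sort (· ≤ ·) = List.ofFn (y ∘ Tuple.sort y) := by
    refine List.Perm.eq_of_pairwise' (Multiset.pairwise_sort _ _)
      (Tuple.monotone_sort y).sortedLE_ofFn.pairwise (Multiset.coe_eq_coe.mp ?_)
    rw [Multiset.sort_eq, roots_prod_X_sub_C_comp, Fin.univ_val_map]
    exact Multiset.coe_eq_coe.mpr ((Tuple.sort y).ofFn_comp_perm y).symm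
  rw [orderedRoot, hsort, List.getD_eq_getElem _ _ (by rw [List.length_ofFn]; exact j.2),
    List.getElem_ofFn, Function.comp_apply]

theorem eq_prod_X_sub_C_orderedRoot {p : ℝ[X]} (hsplits : p.Splits) (hmonic : p.Monic) :
    p = ∏ k : Fin p.natDegree, (X - C (orderedRoot p k)) := by
  have hroots := congrArg (fun s : Multiset ℝ => (s.map (X - C ·)).prod)
    (map_orderedRoot hsplits.natDegree_eq_card_roots.symm)
  simp only [Multiset.map_map] at hroots
  exact (hsplits.eq_prod_roots_of_monic hmonic).trans hroots.symm

theorem cubic_toPoly_eq_prod_iff {R : Type*} [CommRing R] {c₀ c₁ c₂ : R} {y : Fin 3 → R} :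
    (Cubic.mk 1 c₂ c₁ c₀).toPoly = ∏ k, (X - C (y k)) ↔
      y 0 + y 1 + y 2 = -c₂ ∧ y 0 * y 1 + y 1 * y 2 + y 2 * y 0 = c₁ ∧
        y 0 * y 1 * y 2 = -c₀ := by
  rw [Fin.prod_univ_three, Cubic.prod_X_sub_C_eq, Cubic.toPoly_injective, Cubic.mk.injEq]
  constructor
  · rintro ⟨-, hsum, hpairs, hprod⟩
    exact ⟨by rw [hsum, neg_neg], by rw [hpairs]; ring, by rw [hprod, neg_neg]⟩
  · rintro ⟨hsum, hpairs, hprod⟩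
    exact ⟨rfl, by rw [hsum, neg_neg], by rw [← hpairs]; ring, by rw [hprod, neg_neg]⟩

theorem isRootTriple_iff_toPoly_eq_prod {R : Type*} [CommRing R] {A B : R} {x : Fin 3 → R} :
    IsRootTriple A B x ↔ (Cubic.mk 1 0 (-3 * A) (-(2 * B))).toPoly = ∏ k, (X - C (x k)) := by
  rw [cubic_toPoly_eq_prod_iff, neg_zero, neg_neg]
  exact ⟨fun h => ⟨h.sum_eq, h.pairs_eq, h.prod_eq⟩, fun h => ⟨h.1, h.2.1, h.2.2⟩⟩

theorem IsRootTriple.comp_perm {R : Type*} [CommRing R] {A B : R} {x : Fin 3 → R}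
    (hx : IsRootTriple A B x) (σ : Equiv.Perm (Fin 3)) : IsRootTriple A B (x ∘ σ) :=
  isRootTriple_iff_toPoly_eq_prod.mpr <| (isRootTriple_iff_toPoly_eq_prod.mp hx).trans
    (Equiv.prod_comp σ fun k => X - C (x k)).symm

theorem S3_eq_image : S3 = Finset.univ.image fun k : Fin 3 => (k, k + 1, k + 2) := by
  decide

theorem sum_S3 {M : Type*} [AddCommMonoid M] (f : Fin 3 × Fin 3 × Fin 3 → M) :
    ∑ i ∈ S3, f i = ∑ k, f (k, k + 1, k + 2) := by
  rw [S3_eq_image, Finset.sum_image fun _ _ _ _ h => (Prod.ext_iff.mp h).1]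

theorem forall_mem_S3 {q : Fin 3 × Fin 3 × Fin 3 → Prop} :
    (∀ i ∈ S3, q i) ↔ ∀ k, q (k, k + 1, k + 2) := by
  simp only [S3_eq_image, Finset.forall_mem_image, Finset.mem_univ, forall_const]

end Roots

section DepressedSymbol

variable (a : Fin 3 → ℝ → ℝ) (b : Fin 3 → ℝ → ℂ)

/-- The coefficient `A` of the depressed cubic `X ^ 3 - 3 A X - 2 B` whose roots are the
`τ_j(t, 1) + a₂(t) / 3`. -/
noncomputable def depressedA (t : ℝ) : ℝ := a 2 t ^ 2 / 9 - a 1 t / 3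

/-- The coefficient `B` of the depressed cubic `X ^ 3 - 3 A X - 2 B` whose roots are the
`τ_j(t, 1) + a₂(t) / 3`. -/
noncomputable def depressedB (t : ℝ) : ℝ := a 1 t * a 2 t / 6 - a 2 t ^ 3 / 27 - a 0 t / 2

/-- The coefficients of the subprincipal symbol as a polynomial in the variable
`τ / ξ + a₂(t) / 3` of the depressed cubic. -/
noncomputable def depressedCoeff (t : ℝ) : Fin 3 → ℂ :=
  ![b 0 t - (deriv (a 1) t / 2 : ℝ) - (a 2 t / 3 : ℝ) * (b 1 t - (deriv (a 2) t : ℝ)) +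
      (a 2 t / 3 : ℝ) ^ 2 * b 2 t,
    b 1 t - (deriv (a 2) t : ℝ) - 2 * (a 2 t / 3 : ℝ) * b 2 t, b 2 t]

/-- Coefficients for which `symbolL` is the auxiliary polynomial `L - ∂_τ² L` at the frequencies
`ξ = ± ε⁻¹`. -/
def auxCoeff (ε : ℝ) : Fin 3 → ℝ → ℝ :=
  ![fun t => a 0 t - 2 * ε ^ 2 * a 2 t, fun t => a 1 t - 6 * ε ^ 2, a 2]

variable {a b} {t ξ : ℝ} {x : Fin 3 → ℝ}

theorem symbolL_eq_toPoly (a : Fin 3 → ℝ → ℝ) (t ξ : ℝ) : symbolL a t ξ =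
    (Cubic.mk 1 (a 2 t * ξ) (a 1 t * ξ ^ 2) (a 0 t * ξ ^ 3)).toPoly := by
  simp only [symbolL, Cubic.toPoly, Fin.sum_univ_three, Fin.val_zero, Fin.val_one, Fin.val_two,
    Nat.sub_zero, Nat.reduceSub, pow_zero, pow_one, mul_one, C_1, one_mul]
  ring

theorem IsRootTriple.symbolL_eq_prod (hx : IsRootTriple (depressedA a t) (depressedB a t) x)
    (ξ : ℝ) : symbolL a t ξ = ∏ k, (X - C (ξ * (x k - a 2 t / 3))) := by
  obtain ⟨hsum, hpairs, hprod⟩ := hx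
  rw [depressedA] at hpairs
  rw [depressedB] at hprod
  rw [symbolL_eq_toPoly, cubic_toPoly_eq_prod_iff]
  refine ⟨?_, ?_, ?_⟩
  · linear_combination ξ * hsum
  · linear_combination ξ ^ 2 * hpairs - 2 * ξ ^ 2 * (a 2 t / 3) * hsum
  · linear_combination ξ ^ 3 * hprod - ξ ^ 3 * (a 2 t / 3) * hpairs +
      ξ ^ 3 * (a 2 t / 3) ^ 2 * hsum

theorem isRootTriple_tauRoot_one (h : (symbolL a t 1).Splits) :
    IsRootTriple (depressedA a t) (depressedB a t) fun k => tauRoot a k t 1 + a 2 t / 3 := by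
  rw [symbolL_eq_toPoly] at h
  have hprod := eq_prod_X_sub_C_orderedRoot h Cubic.monic_of_a_eq_one'
  rw [Cubic.natDegree_of_a_ne_zero' one_ne_zero, cubic_toPoly_eq_prod_iff] at hprod
  obtain ⟨hsum, hpairs, hprod⟩ := hprod
  rw [depressedA, depressedB]
  simp only [tauRoot, symbolL_eq_toPoly]
  constructor
  · linear_combination hsum
  · linear_combination hpairs + 2 * (a 2 t / 3) * hsum
  · linear_combination hprod + (a 2 t / 3) * hpairs + (a 2 t / 3) ^ 2 * hsum

theorem depressedB_sq_le (h : (symbolL a t 1).Splits) : depressedB a t ^ 2 ≤ depressedA a t ^ 3 :=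
  (isRootTriple_tauRoot_one h).sq_le_cube

theorem IsRootTriple.exists_perm_tauRoot
    (hx : IsRootTriple (depressedA a t) (depressedB a t) x) (ξ : ℝ) :
    ∃ σ : Equiv.Perm (Fin 3), ∀ k, tauRoot a k t ξ = ξ * (x (σ k) - a 2 t / 3) :=
  ⟨Tuple.sort fun k => ξ * (x k - a 2 t / 3), fun k => by
    rw [tauRoot, hx.symbolL_eq_prod, orderedRoot_prod_X_sub_C]⟩

theorem auxL_eq_symbolL (a : Fin 3 → ℝ → ℝ) (t : ℝ) (hξ : ξ ≠ 0) :
    auxL a t ξ = symbolL (auxCoeff a |ξ|⁻¹) t ξ := by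
  have hinv : |ξ|⁻¹ ^ 2 * ξ ^ 2 = 1 := by rw [inv_pow, sq_abs, inv_mul_cancel₀ (pow_ne_zero 2 hξ)]
  have h₀ : (a 0 t - 2 * |ξ|⁻¹ ^ 2 * a 2 t) * ξ ^ 3 = a 0 t * ξ ^ 3 - 2 * (a 2 t * ξ) := by
    linear_combination -2 * a 2 t * ξ * hinv
  have h₁ : (a 1 t - 6 * |ξ|⁻¹ ^ 2) * ξ ^ 2 = a 1 t * ξ ^ 2 - 6 := by
    linear_combination -6 * hinv
  rw [auxL, symbolL_eq_toPoly, symbolL_eq_toPoly]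
  simp only [auxCoeff, Matrix.cons_val, h₀, h₁, Cubic.toPoly, derivative_add, derivative_mul,
    derivative_C, derivative_X, derivative_X_pow, derivative_zero, derivative_one,
    derivative_natCast, C_1, C_sub, C_mul, map_ofNat, map_natCast]
  ring

theorem depressedA_auxCoeff (a : Fin 3 → ℝ → ℝ) (ε t : ℝ) :
    depressedA (auxCoeff a ε) t = depressedA a t + 2 * ε ^ 2 := by
  simp only [depressedA, auxCoeff, Matrix.cons_val]
  ring

theorem depressedB_auxCoeff (a : Fin 3 → ℝ → ℝ) (ε t : ℝ) :
    depressedB (auxCoeff a ε) t = depressedB a t := by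
  simp only [depressedB, auxCoeff, Matrix.cons_val]
  ring

theorem IsRootTriple.exists_perm_lambdaRoot (hξ : ξ ≠ 0)
    (hx : IsRootTriple (depressedA a t + 2 * |ξ|⁻¹ ^ 2) (depressedB a t) x) :
    ∃ σ : Equiv.Perm (Fin 3), ∀ k, lambdaRoot a k t ξ = ξ * (x (σ k) - a 2 t / 3) := by
  rw [← depressedA_auxCoeff, ← depressedB_auxCoeff a |ξ|⁻¹] at hx
  obtain ⟨σ, hσ⟩ := hx.exists_perm_tauRoot ξ
  exact ⟨σ, fun k => by rw [lambdaRoot, auxL_eq_symbolL a t hξ]; exact hσ k⟩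

theorem discrL_eq (h : (symbolL a t 1).Splits) (ξ : ℝ) :
    discrL a t ξ = 108 * ξ ^ 6 * (depressedA a t ^ 3 - depressedB a t ^ 2) := by
  have hx := isRootTriple_tauRoot_one h
  obtain ⟨σ, hσ⟩ := hx.exists_perm_tauRoot ξ
  have hdiscr := (hx.comp_perm σ).discr_eq
  simp only [Function.comp_apply] at hdiscr
  simp only [discrL, hσ]
  linear_combination ξ ^ 6 * hdiscr

theorem deriv_eval_derivative_symbolL (ha₁ : DifferentiableAt ℝ (a 1) t)
    (ha₂ : DifferentiableAt ℝ (a 2) t) (τ ξ : ℝ) :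
    deriv (fun s => (derivative (symbolL a s ξ)).eval τ) t =
      2 * (deriv (a 2) t * ξ) * τ + deriv (a 1) t * ξ ^ 2 := by
  have heval (s : ℝ) : (derivative (symbolL a s ξ)).eval τ =
      3 * τ ^ 2 + 2 * (a 2 s * ξ) * τ + a 1 s * ξ ^ 2 := by
    simp only [symbolL_eq_toPoly, Cubic.toPoly, derivative_add, derivative_mul, derivative_C,
      derivative_X, derivative_X_pow, eval_add, eval_mul, eval_C, eval_X, eval_pow, eval_zero,
      eval_one]
    ring
  simp only [heval]
  exact ((((ha₂.hasDerivAt.mul_const ξ).const_mul 2).mul_const τ).const_add (3 * τ ^ 2)).add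
    (ha₁.hasDerivAt.mul_const (ξ ^ 2)) |>.deriv

theorem norm_checkM_eq (ha₁ : DifferentiableAt ℝ (a 1) t) (ha₂ : DifferentiableAt ℝ (a 2) t)
    (b : Fin 3 → ℝ → ℂ) (y ξ : ℝ) : ‖checkM a b t (ξ * (y - a 2 t / 3)) ξ‖ =
      ξ ^ 2 * ‖quad (depressedCoeff a b t) y‖ := by
  have hquad : checkM a b t (ξ * (y - a 2 t / 3)) ξ =
      (ξ : ℂ) ^ 2 * quad (depressedCoeff a b t) y := by
    rw [checkM, deriv_eval_derivative_symbolL ha₁ ha₂]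
    simp only [symbolM, quad, depressedCoeff, Fin.sum_univ_three, Fin.val_zero, Fin.val_one,
      Fin.val_two, Nat.sub_zero, Nat.reduceSub, pow_zero, pow_one, Complex.real_smul,
      Matrix.cons_val, Complex.ofReal_add, Complex.ofReal_sub, Complex.ofReal_mul,
      Complex.ofReal_div, Complex.ofReal_pow, Complex.ofReal_ofNat]
    ring
  rw [hquad, norm_mul, norm_pow, Complex.norm_real, Real.norm_eq_abs, sq_abs]

theorem IsRootTriple.abs_gap_mul_abs_gap {A B : ℝ} (hx : IsRootTriple A B x) (ξ α : ℝ)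
    (k : Fin 3) :
    |ξ * (x k - α) - ξ * (x (k + 1) - α)| * |ξ * (x k - α) - ξ * (x (k + 2) - α)| =
      ξ ^ 2 * |3 * (x k ^ 2 - A)| := by
  rw [← hx.gap_mul_gap k, ← abs_mul, ← abs_of_nonneg (sq_nonneg ξ), ← abs_mul]
  congr 1
  ring

theorem leviIntegrand_eq (ha₁ : DifferentiableAt ℝ (a 1) t) (ha₂ : DifferentiableAt ℝ (a 2) t)
    (b : Fin 3 → ℝ → ℂ) (h : (symbolL a t 1).Splits) (hξ : ξ ≠ 0) : leviIntegrand a b t ξ =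
      perturbedResidue (depressedA a) (depressedB a) (depressedCoeff a b) |ξ|⁻¹ t := by
  have hx := isRootTriple_vieteRoot_perturbed (depressedB_sq_le h) |ξ|⁻¹
  obtain ⟨σ, hσ⟩ := hx.exists_perm_lambdaRoot hξ
  rw [perturbedResidue, residueSum, ← Equiv.sum_comp σ, leviIntegrand, sum_S3]
  refine Finset.sum_congr rfl fun k _ => ?_
  simp only [hσ]
  rw [norm_checkM_eq ha₁ ha₂]
  have hgap := (hx.comp_perm σ).abs_gap_mul_abs_gap ξ (a 2 t / 3) k
  simp only [Function.comp_apply] at hgap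
  rw [hgap, mul_div_mul_left _ _ (pow_ne_zero 2 hξ)]

theorem IsRootTriple.forall_mem_S3_iff (hx : IsRootTriple (depressedA a t) (depressedB a t) x)
    (ha₁ : DifferentiableAt ℝ (a 1) t) (ha₂ : DifferentiableAt ℝ (a 2) t) (b : Fin 3 → ℝ → ℂ)
    (c K ξ : ℝ) :
    (∀ i ∈ S3, c * ‖checkM a b t (tauRoot a i.1 t ξ) ξ‖ ≤
      K * (|tauRoot a i.1 t ξ - tauRoot a i.2.1 t ξ| *
        |tauRoot a i.1 t ξ - tauRoot a i.2.2 t ξ|)) ↔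
    ∀ k, ξ ^ 2 * (c * ‖quad (depressedCoeff a b t) (x k)‖) ≤
      ξ ^ 2 * (K * |3 * (x k ^ 2 - depressedA a t)|) := by
  obtain ⟨σ, hσ⟩ := hx.exists_perm_tauRoot ξ
  rw [forall_mem_S3]
  refine Iff.trans (forall_congr' fun k => ?_) (σ.forall_congr_right (q := fun k =>
    ξ ^ 2 * (c * ‖quad (depressedCoeff a b t) (x k)‖) ≤
      ξ ^ 2 * (K * |3 * (x k ^ 2 - depressedA a t)|)))
  simp only [hσ]
  have hgap := (hx.comp_perm σ).abs_gap_mul_abs_gap ξ (a 2 t / 3) k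
  simp only [Function.comp_apply] at hgap
  rw [norm_checkM_eq ha₁ ha₂, hgap, mul_left_comm, mul_left_comm K]

end DepressedSymbol

section LogBoundIffPointwise

open Filter Topology

theorem eventually_nhdsNE_ne_zero {f : ℝ → ℝ} {s : Set ℝ} (hf : AnalyticOnNhd ℝ f s)
    (hs : IsPreconnected s) (hne : ∃ t ∈ s, f t ≠ 0) : ∀ z ∈ s, ∀ᶠ t in 𝓝[≠] z, f t ≠ 0 := by
  intro z hz
  by_contra hzeros
  obtain ⟨t, ht, htne⟩ := hne
  exact htne <| hf.eqOn_zero_of_preconnected_of_frequently_eq_zero hs hz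
    ((not_eventually.mp hzeros).mono fun _ => not_not.mp) ht

theorem finite_sep_of_eventually_nhdsNE_not {X : Type*} [TopologicalSpace X] {K : Set X}
    {p : X → Prop} (hK : IsCompact K) (h : ∀ z ∈ K, ∀ᶠ t in 𝓝[≠] z, ¬p t) :
    {t ∈ K | p t}.Finite := by
  have hcodiscrete : {t | ¬p t} ∈ codiscreteWithin K :=
    mem_codiscreteWithin_iff_forall_mem_nhdsNE.mpr fun z hz =>
      mem_of_superset (h z hz) subset_union_left
  exact (hK.finite_sdiff_of_mem_codiscreteWithin hcodiscrete).subset fun t ht =>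
    ⟨ht.1, fun hn => hn ht.2⟩

theorem hasLogBound_iff_exists_hasPointwiseBound {E : Type*} [NormedAddCommGroup E]
    [InnerProductSpace ℝ E] {A B : ℝ → ℝ} {d : ℝ → Fin 3 → E} {l u ε₀ : ℝ} {U : Set ℝ}
    (hlu : l < u) (hε₀ : 0 < ε₀) (hA : AnalyticOnNhd ℝ A (Icc l u))
    (hB : AnalyticOnNhd ℝ B (Icc l u)) (hd : AnalyticOnNhd ℝ d (Icc l u))
    (hAB : ∀ t ∈ Icc l u, B t ^ 2 ≤ A t ^ 3)
    (hne : ∀ z ∈ Icc l u, ∀ᶠ t in 𝓝[≠] z, A t ^ 3 ≠ B t ^ 2) (hU : Icc l u ⊆ U) :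
    HasLogBound A B d l u ε₀ ↔ ∃ S : Finset ℝ, (S : Set ℝ) ⊆ U ∧ ∃ K > 0,
      HasPointwiseBound A B d (Icc l u) S K := by
  constructor
  · intro hlog
    obtain ⟨S, hS, K, hK, hpoint⟩ := hlog.exists_hasPointwiseBound hlu hε₀ hA hB hd hAB hne
    exact ⟨S, hS.trans hU, K + 1, by positivity, fun t ht x hx k =>
      (hpoint t ht x hx k).trans (by gcongr; exact le_add_of_nonneg_right zero_le_one)⟩
  · rintro ⟨S, -, K, hK, hpoint⟩
    exact hpoint.hasLogBound hlu.le hK.le hε₀ hA.continuousOn hB.continuousOn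
      hd.continuousOn hAB (finite_sep_of_eventually_nhdsNE_not isCompact_Icc hne)

end LogBoundIffPointwise

section LeviConditions

open Filter Topology

variable {T δ R : ℝ} {a : Fin 3 → ℝ → ℝ} {b : Fin 3 → ℝ → ℂ} {s : Set ℝ}

theorem logLevi_iff (hT : 0 ≤ T) (hR : 0 < R) (b : Fin 3 → ℝ → ℂ)
    (ha₁ : ∀ t ∈ Icc 0 T, DifferentiableAt ℝ (a 1) t)
    (ha₂ : ∀ t ∈ Icc 0 T, DifferentiableAt ℝ (a 2) t)
    (hsplits : ∀ t ∈ Icc 0 T, (symbolL a t 1).Splits) : LogLevi T R a b ↔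
      HasLogBound (depressedA a) (depressedB a) (depressedCoeff a b) 0 T R⁻¹ := by
  have hcongr {ξ : ℝ} (hξ : R ≤ |ξ|) : EqOn (fun t => leviIntegrand a b t ξ)
      (perturbedResidue (depressedA a) (depressedB a) (depressedCoeff a b) |ξ|⁻¹) (uIcc 0 T) := by
    intro t ht
    rw [uIcc_of_le hT] at ht
    exact leviIntegrand_eq (ha₁ t ht) (ha₂ t ht) b (hsplits t ht) (abs_pos.mp (hR.trans_le hξ))
  refine exists_congr fun K => and_congr_right fun _ => ⟨fun h ε hε => ?_, fun h ξ hξ => ?_⟩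
  · have hinv : |ε⁻¹| = ε⁻¹ := abs_of_pos (inv_pos.mpr hε.1)
    have hξ : R ≤ |ε⁻¹| := hinv.ge.trans' ((le_inv_comm₀ hε.1 hR).mp hε.2)
    have hbound := h ε⁻¹ hξ
    rwa [intervalIntegrable_congr ((hcongr hξ).mono uIoc_subset_uIcc),
      intervalIntegral.integral_congr (hcongr hξ), hinv, inv_inv] at hbound
  · have hpos : 0 < |ξ| := hR.trans_le hξ
    have hbound := h |ξ|⁻¹ ⟨inv_pos.mpr hpos, inv_anti₀ hR hξ⟩
    rwa [← intervalIntegrable_congr ((hcongr hξ).mono uIoc_subset_uIcc),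
      ← intervalIntegral.integral_congr (hcongr hξ), inv_inv] at hbound

theorem pointwiseLevi_iff (b : Fin 3 → ℝ → ℂ)
    (ha₁ : ∀ t ∈ Icc 0 T, DifferentiableAt ℝ (a 1) t)
    (ha₂ : ∀ t ∈ Icc 0 T, DifferentiableAt ℝ (a 2) t)
    (hsplits : ∀ t ∈ Icc 0 T, (symbolL a t 1).Splits) : PointwiseLevi T δ a b ↔
      ∃ S : Finset ℝ, (S : Set ℝ) ⊆ Ioo (-δ) (T + δ) ∧ ∃ K > 0,
        HasPointwiseBound (depressedA a) (depressedB a) (depressedCoeff a b) (Icc 0 T) S K := by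
  refine exists_congr fun S => and_congr_right fun _ => exists_congr fun K =>
    and_congr_right fun _ => ⟨fun h t ht x hx k => ?_, fun h i hi t ht ξ => ?_⟩
  · simpa only [one_pow, one_mul] using
      (hx.forall_mem_S3_iff (ha₁ t ht) (ha₂ t ht) b _ K 1).mp (fun i hi => h i hi t ht 1) k
  · have hx := isRootTriple_tauRoot_one (hsplits t ht)
    exact (hx.forall_mem_S3_iff (ha₁ t ht) (ha₂ t ht) b _ K ξ).mpr
      (fun k => mul_le_mul_of_nonneg_left (h t ht _ hx k) (sq_nonneg ξ)) i hi

theorem analyticOnNhd_depressedA (ha : ∀ j, AnalyticOnNhd ℝ (a j) s) :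
    AnalyticOnNhd ℝ (depressedA a) s := fun t ht => by
  have h₁ := ha 1 t ht
  have h₂ := ha 2 t ht
  unfold depressedA
  fun_prop

theorem analyticOnNhd_depressedB (ha : ∀ j, AnalyticOnNhd ℝ (a j) s) :
    AnalyticOnNhd ℝ (depressedB a) s := fun t ht => by
  have h₀ := ha 0 t ht
  have h₁ := ha 1 t ht
  have h₂ := ha 2 t ht
  unfold depressedB
  fun_prop

theorem analyticOnNhd_depressedCoeff (ha : ∀ j, AnalyticOnNhd ℝ (a j) s)
    (hb : ∀ j, AnalyticOnNhd ℝ (b j) s) : AnalyticOnNhd ℝ (depressedCoeff a b) s := by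
  have hofReal (r : ℝ) : AnalyticAt ℝ (fun r : ℝ => (r : ℂ)) r := Complex.ofRealCLM.analyticAt r
  refine AnalyticOnNhd.pi fun j t ht => ?_
  have hb₀ := hb 0 t ht
  have hb₁ := hb 1 t ht
  have hb₂ := hb 2 t ht
  have ha₂ := ha 2 t ht
  have hda₁ := (ha 1 t ht).deriv
  have hda₂ := ha₂.deriv
  match j with
  | 0 | 1 | 2 =>
    simp only [depressedCoeff, Matrix.cons_val]
    fun_prop

theorem eventually_depressed_cube_ne_sq (ha : ∀ j, AnalyticOnNhd ℝ (a j) (Icc 0 T))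
    (hyp : WeaklyHyperbolic T a) (hdiscr : ∃ t ∈ Icc 0 T, ∃ ξ, discrL a t ξ ≠ 0) :
    ∀ z ∈ Icc 0 T, ∀ᶠ t in 𝓝[≠] z, depressedA a t ^ 3 ≠ depressedB a t ^ 2 := by
  obtain ⟨t, ht, ξ, hξ⟩ := hdiscr
  rw [discrL_eq (hyp t ht 1)] at hξ
  have hdisc : AnalyticOnNhd ℝ (fun t => depressedA a t ^ 3 - depressedB a t ^ 2) (Icc 0 T) :=
    ((analyticOnNhd_depressedA ha).pow 3).sub ((analyticOnNhd_depressedB ha).pow 2)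
  exact fun z hz => (eventually_nhdsNE_ne_zero hdisc isPreconnected_Icc
    ⟨t, ht, right_ne_zero_of_mul hξ⟩ z hz).mono fun _ => sub_ne_zero.mp

end LeviConditions

end ThirdOrder

open ThirdOrder in
theorem mainTheorem9 (T δ R : ℝ) (hT : 0 < T) (hδ : 0 < δ) (hR : 0 < R)
    (a : Fin 3 → ℝ → ℝ) (b : Fin 3 → ℝ → ℂ)
    (ha : ∀ j, AnalyticOnNhd ℝ (a j) (Set.Ioo (-δ) (T + δ)))
    (hb : ∀ j, AnalyticOnNhd ℝ (b j) (Set.Ioo (-δ) (T + δ)))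
    (hyp : ThirdOrder.WeaklyHyperbolic T a)
    (hdiscr : ∃ t ∈ Set.Icc 0 T, ∃ ξ : ℝ, ThirdOrder.discrL a t ξ ≠ 0) :
    ThirdOrder.LogLevi T R a b ↔ ThirdOrder.PointwiseLevi T δ a b := by
  have hsub : Icc 0 T ⊆ Ioo (-δ) (T + δ) :=
    Icc_subset_Ioo (neg_lt_zero.mpr hδ) (lt_add_of_pos_right T hδ)
  replace ha (j : Fin 3) := (ha j).mono hsub
  replace hb (j : Fin 3) := (hb j).mono hsub
  have hdiff (j : Fin 3) (t : ℝ) (ht : t ∈ Icc 0 T) : DifferentiableAt ℝ (a j) t :=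
    (ha j t ht).differentiableAt
  have hsplits (t : ℝ) (ht : t ∈ Icc 0 T) : (symbolL a t 1).Splits := hyp t ht 1
  rw [logLevi_iff hT.le hR b (hdiff 1) (hdiff 2) hsplits,
    pointwiseLevi_iff b (hdiff 1) (hdiff 2) hsplits]
  exact hasLogBound_iff_exists_hasPointwiseBound hT (inv_pos.mpr hR)
    (analyticOnNhd_depressedA ha) (analyticOnNhd_depressedB ha)
    (analyticOnNhd_depressedCoeff ha hb) (fun t ht => depressedB_sq_le (hsplits t ht))
    (eventually_depressed_cube_ne_sq ha hyp hdiscr) hsub
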